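/- Let $n\ge 1$ and let $1\le p\le \frac{n}{n-1}$ (for $n=1$ this reads $1\le p\le\infty$). Then there exists a constant $c=c(n,p)>0$ with the following property. For every $u\in \mathrm{BD}(\mathbb R^n)$, i.e. every $u\in L^1(\mathbb R^n;\mathbb R^n)$ whose total deformation $$|Eu|(\mathbb R^n):=\sup\Big\{\int_{\mathbb R^n}\langle u,\operatorname{div}\varphi\rangle\,dx:\ \varphi\in C^1_c(\mathbb R^n;\mathbb R^{n\times n}_{\mathrm{sym}}),\ \sup_x|\varphi(x)|\le 1\Big\}$$ is finite (with $\operatorname{div}$ the row-wise divergence and $|\cdot|$ the Frobenius norm), for every $\varepsilon>0$, and for every standard mollifier $\rho$, one has $$\|u-\rho_\varepsilon*u\|_{L^p(\mathbb R^n;\mathbb R^n)}\ \le\ c\,\varepsilon^{\,1-n+\frac np}\,|Eu|(\mathbb R^n),$$ where $\frac np:=0$ if $p=\infty$. Here a standard mollifier is a radial function $\rho:\mathbb R^n\to[0,\infty)$ with $\int_{\mathbb R^n}\rho\,dx=1$ and $\operatorname{spt}\rho\subset\overline{B(0,1)}$ that is of class $C^\infty$ in the open ball $B(0,1)$, and $\rho_\varepsilon(x):=\varepsilon^{-n}\rho(x/\varepsilon)$.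 -/

import Mathlib

open MeasureTheory
open scoped ENNReal ContDiff

/-- Admissible test fields for the total deformation: symmetric-matrix-valued `C¹` fields with
compact support on `ℝⁿ` whose Frobenius norm is at most `1` at every point. -/
structure IsDeformationTest {n : ℕ}
    (φ : EuclideanSpace ℝ (Fin n) → Matrix (Fin n) (Fin n) ℝ) : Prop where
  contDiff : ∀ i j, ContDiff ℝ 1 (fun x => φ x i j)
  hasCompactSupport : HasCompactSupport φ
  symm : ∀ x, (φ x).IsSymm
  frobenius_le_one : ∀ x, Real.sqrt (∑ i, ∑ j, (φ x i j) ^ 2) ≤ 1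

/-- The `i`-th component of the row-wise divergence of a matrix field,
`(div φ)ᵢ = ∑ⱼ ∂ⱼ φᵢⱼ`. -/
noncomputable def rowDiv {n : ℕ} (φ : EuclideanSpace ℝ (Fin n) → Matrix (Fin n) (Fin n) ℝ)
    (x : EuclideanSpace ℝ (Fin n)) (i : Fin n) : ℝ :=
  ∑ j, fderiv ℝ (fun y => φ y i j) x (EuclideanSpace.single j 1)

/-- The total deformation `|Eu|(ℝⁿ)`: the supremum of `∫ ⟨u, div φ⟩ dx` over all admissible test
fields. (As `φ` may be replaced by `-φ`, truncating negative integrals to `0` changes nothing.) -/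
noncomputable def totalDeformation {n : ℕ}
    (u : EuclideanSpace ℝ (Fin n) → EuclideanSpace ℝ (Fin n)) : ℝ≥0∞ :=
  ⨆ (φ : EuclideanSpace ℝ (Fin n) → Matrix (Fin n) (Fin n) ℝ) (_ : IsDeformationTest φ),
    ENNReal.ofReal (∫ x, ∑ i, u x i * rowDiv φ x i)

/-- `u ∈ BD(ℝⁿ)`: `u` is integrable and has finite total deformation. -/
structure MemBD {n : ℕ} (u : EuclideanSpace ℝ (Fin n) → EuclideanSpace ℝ (Fin n)) : Prop where
  integrable : Integrable u volume
  totalDeformation_lt_top : totalDeformation u < (⊤ : ℝ≥0∞)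

/-- Standard mollifiers: nonnegative radial functions of unit mass, supported in the closed unit
ball and smooth in the open unit ball (jumps across the unit sphere are allowed). -/
structure IsStandardMollifier {n : ℕ} (ρ : EuclideanSpace ℝ (Fin n) → ℝ) : Prop where
  nonneg : ∀ x, 0 ≤ ρ x
  radial : ∀ x y, ‖x‖ = ‖y‖ → ρ x = ρ y
  tsupport_subset : tsupport ρ ⊆ Metric.closedBall 0 1
  contDiffOn : ContDiffOn ℝ ∞ ρ (Metric.ball 0 1)
  integrable : Integrable ρ volume
  integral_eq_one : ∫ x, ρ x = 1

/-- The rescaled mollifier `ρ_ε(x) = ε⁻ⁿ ρ(x / ε)`. -/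
noncomputable def rescaledMollifier {n : ℕ} (ρ : EuclideanSpace ℝ (Fin n) → ℝ) (ε : ℝ)
    (x : EuclideanSpace ℝ (Fin n)) : ℝ :=
  (ε ^ n)⁻¹ * ρ (ε⁻¹ • x)

/-- The mollification `(ρ_ε * u)(x) = ∫ ρ_ε(t) u(x - t) dt`. -/
noncomputable def mollify {n : ℕ} (ρ : EuclideanSpace ℝ (Fin n) → ℝ) (ε : ℝ)
    (u : EuclideanSpace ℝ (Fin n) → EuclideanSpace ℝ (Fin n)) :
    EuclideanSpace ℝ (Fin n) → EuclideanSpace ℝ (Fin n) :=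
  convolution (rescaledMollifier ρ ε) u (ContinuousLinearMap.lsmul ℝ ℝ) volume

/-! Only longitudinal differences of `u` are controlled by the deformation: testing with `ψ v ⊗ v /
|v|²` gives `∫ |h · (u(x+h) - u(x))| dx ≤ |h|² |Eu|`, which is `LongitudinalBound`. This condition
uses no derivatives, passes to convolutions and differences, and carries the whole argument.

Near the `L¹` endpoint: since the mollifier is even, `u - ρ_ε * u` is an average of second
differences `u(x+t) + u(x-t) - 2u(x)` with `|t| ≤ ε`. Although single transversal differences are
not controlled, every component of a second difference is a combination of longitudinal ones
(`inner_second_difference`), whence an `L¹` bound of order `ε |Eu|`.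

At the critical endpoint `n/(n-1)`: `v = u - ρ_ε * u` has longitudinal bound `2|Eu|`, and Strauss'
inequality bounds its critical norm by `|Eu|`. Each `ξ · v` is bounded by an integral along a line
parallel to `ξ`, so a Gagliardo–Nirenberg inequality in oblique coordinates bounds products of `n`
such components. Among `2n - 1` directions in general position, at least `n` always see the full
size of `v`, so these products bound a power of `|v|`. For `n = 1` the endpoint is a sup bound.

Hölder interpolation with weight `θ = 1 - n + n/p` on `L¹` then yields `ε^θ`. -/

open Filter Set Topology Metric

/-! ### Smooth approximate identities -/

section Mollifiers

variable {E : Type*} [NormedAddCommGroup E] [InnerProductSpace ℝ E]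
  [FiniteDimensional ℝ E] [MeasurableSpace E] [BorelSpace E]

/-- A sequence of smooth bump functions shrinking to the origin. -/
noncomputable def shrinkingBump (E : Type*) [NormedAddCommGroup E] [InnerProductSpace ℝ E] (k : ℕ) :
    ContDiffBump (0 : E) where
  rIn := 1 / ((k : ℝ) + 1)
  rOut := 2 * (1 / ((k : ℝ) + 1))
  rIn_pos := by positivity
  rIn_lt_rOut := by
    have : (0 : ℝ) < 1 / ((k : ℝ) + 1) := by positivity
    linarith

/-- Smooth compactly supported approximate identity. -/
noncomputable def approxIdentity (E : Type*) [NormedAddCommGroup E] [InnerProductSpace ℝ E]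
    [FiniteDimensional ℝ E] [MeasurableSpace E] [BorelSpace E] (k : ℕ) : E → ℝ :=
  (shrinkingBump E k).normed volume

lemma approxIdentity_contDiff (k : ℕ) {m : ℕ∞} : ContDiff ℝ m (approxIdentity E k) :=
  (shrinkingBump E k).contDiff_normed

lemma approxIdentity_hasCompactSupport (k : ℕ) : HasCompactSupport (approxIdentity E k) :=
  (shrinkingBump E k).hasCompactSupport_normed

lemma approxIdentity_nonneg (k : ℕ) (x : E) : 0 ≤ approxIdentity E k x :=
  (shrinkingBump E k).nonneg_normed x

lemma integral_approxIdentity (k : ℕ) : ∫ x, approxIdentity E k x = 1 :=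
  (shrinkingBump E k).integral_normed

lemma approxIdentity_integrable (k : ℕ) : Integrable (approxIdentity E k) :=
  (shrinkingBump E k).integrable_normed

lemma ae_tendsto_approxIdentity_convolution {F : Type*} [NormedAddCommGroup F] [NormedSpace ℝ F]
    [CompleteSpace F] {g : E → F} (hg : LocallyIntegrable g) :
    ∀ᵐ x, Tendsto (fun k => convolution (approxIdentity E k) g (ContinuousLinearMap.lsmul ℝ ℝ)
      volume x) atTop (𝓝 (g x)) := by
  -- `K = 2` is the fixed ratio of outer to inner radius, so the supports shrink nicely enough for
  -- Lebesgue differentiation.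
  refine ContDiffBump.ae_convolution_tendsto_right_of_locallyIntegrable (K := 2) ?_ ?_ hg
  · have := (tendsto_one_div_add_atTop_nhds_zero_nat (𝕜 := ℝ)).const_mul 2
    simpa [shrinkingBump] using this
  · exact Eventually.of_forall fun k => le_rfl

lemma norm_approxIdentity_convolution_le_one (k : ℕ) {s : E → ℝ} (hs : ∀ x, |s x| ≤ 1) (x : E) :
    |convolution (approxIdentity E k) s (ContinuousLinearMap.lsmul ℝ ℝ) volume x| ≤ 1 := by
  rw [convolution_def, ← Real.norm_eq_abs]
  refine (norm_integral_le_of_norm_le (approxIdentity_integrable k) ?_).trans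
    (integral_approxIdentity k).le
  refine Eventually.of_forall fun t => ?_
  simp only [ContinuousLinearMap.lsmul_apply, smul_eq_mul, norm_mul, Real.norm_eq_abs,
    abs_of_nonneg (approxIdentity_nonneg k t)]
  exact mul_le_of_le_one_right (approxIdentity_nonneg k t) (hs _)

end Mollifiers

/-! ### Duality for the `L¹` norm -/

section Duality

variable {E : Type*} [NormedAddCommGroup E] [InnerProductSpace ℝ E]
  [FiniteDimensional ℝ E] [MeasurableSpace E] [BorelSpace E]

/-- Mollifying `s` gives admissible `ψ` that are bounded by 1 and converge to `s` almost everywhere;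
`|f|` dominates the integrands. -/
lemma integral_mul_le_of_forall_contDiff {f : E → ℝ} (hf : Integrable f) {C : ℝ}
    (h : ∀ ψ : E → ℝ, ContDiff ℝ 1 ψ → HasCompactSupport ψ → (∀ x, |ψ x| ≤ 1) →
      ∫ x, f x * ψ x ≤ C)
    {s : E → ℝ} (hsm : Measurable s) (hs : ∀ x, |s x| ≤ 1) (hsc : HasCompactSupport s) :
    ∫ x, f x * s x ≤ C := by
  have hsi : Integrable s := by
    have h1 : IntegrableOn s (tsupport s) :=
      Measure.integrableOn_of_bounded (M := 1) hsc.isCompact.measure_lt_top.ne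
        hsm.aestronglyMeasurable
        (Eventually.of_forall hs)
    exact (integrableOn_iff_integrable_of_support_subset (subset_tsupport s)).1 h1
  have hcd : ∀ k, ContDiff ℝ 1 (convolution (approxIdentity E k) s
      (ContinuousLinearMap.lsmul ℝ ℝ) volume) := fun k =>
    (approxIdentity_hasCompactSupport k).contDiff_convolution_left (n := 1) _
      (approxIdentity_contDiff k) hsi.locallyIntegrable
  have hlim : Tendsto (fun k => ∫ x, f x * convolution (approxIdentity E k) s
      (ContinuousLinearMap.lsmul ℝ ℝ) volume x) atTop (𝓝 (∫ x, f x * s x)) := by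
    refine tendsto_integral_of_dominated_convergence (fun x => ‖f x‖) (fun k => ?_) hf.norm
      (fun k => Eventually.of_forall fun x => ?_) ?_
    · exact hf.1.mul (hcd k).continuous.aestronglyMeasurable
    · rw [norm_mul]
      exact mul_le_of_le_one_right (norm_nonneg _) (norm_approxIdentity_convolution_le_one k hs x)
    · filter_upwards [ae_tendsto_approxIdentity_convolution hsi.locallyIntegrable] with x hx
      exact hx.const_mul _
  refine le_of_tendsto' hlim fun k => h _ (hcd k) ?_ fun x =>
    norm_approxIdentity_convolution_le_one k hs x
  exact (approxIdentity_hasCompactSupport k).convolution _ hsc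

/-- The `L¹` norm is determined by duality with continuously differentiable, compactly supported
functions. -/
lemma lintegral_enorm_le_of_forall_contDiff {f : E → ℝ} (hf : Integrable f) {C : ℝ}
    (h : ∀ ψ : E → ℝ, ContDiff ℝ 1 ψ → HasCompactSupport ψ → (∀ x, |ψ x| ≤ 1) →
      ∫ x, f x * ψ x ≤ C) :
    ∫⁻ x, ‖f x‖ₑ ≤ ENNReal.ofReal C := by
  have hball : ∀ R : ℕ, ∫ x in closedBall (0 : E) R, |f x| ≤ C := by
    intro R
    -- The sign is taken of a measurable representative, and cut off to a ball to have compact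
    -- support.
    obtain ⟨g, hgm, hfg⟩ := hf.1.aemeasurable
    have key := integral_mul_le_of_forall_contDiff hf h
      (s := (closedBall (0 : E) R).indicator fun x => Real.sign (g x)) ?_ ?_ ?_
    · refine le_trans (le_of_eq ?_) key
      rw [← integral_indicator isClosed_closedBall.measurableSet]
      refine integral_congr_ae ?_
      filter_upwards [hfg] with x hx
      by_cases hxR : x ∈ closedBall (0 : E) R
      · simp only [indicator_of_mem hxR, ← hx]
        rcases lt_trichotomy (f x) 0 with h | h | h
        · simp [Real.sign_of_neg h, abs_of_neg h]
        · simp [h]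
        · simp [Real.sign_of_pos h, abs_of_pos h]
      · simp [indicator_of_notMem hxR]
    · refine Measurable.indicator ?_ isClosed_closedBall.measurableSet
      have : Measurable Real.sign := by
        unfold Real.sign
        exact Measurable.ite measurableSet_Iio measurable_const
          (Measurable.ite measurableSet_Ioi measurable_const measurable_const)
      exact this.comp hgm
    · intro x
      by_cases hxR : x ∈ closedBall (0 : E) R
      · rw [indicator_of_mem hxR]
        rcases Real.sign_apply_eq (g x) with h | h | h <;> simp [h]
      · simp [indicator_of_notMem hxR]
    · exact HasCompactSupport.intro (isCompact_closedBall 0 (R : ℝ))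
        fun x hx => indicator_of_notMem hx _
  have hnorm : ∫ x, |f x| ≤ C := by
    have := (aecover_closedBall (μ := (volume : Measure E)) (x := 0)
      tendsto_natCast_atTop_atTop).integral_tendsto_of_countably_generated hf.abs
    exact le_of_tendsto' this hball
  rw [← ofReal_integral_norm_eq_lintegral_enorm hf]
  exact ENNReal.ofReal_le_ofReal hnorm

end Duality

/-! ### From weak directional derivatives to finite differences -/

section Longitudinal

variable {E : Type*} [NormedAddCommGroup E] [InnerProductSpace ℝ E]
  [FiniteDimensional ℝ E] [MeasurableSpace E] [BorelSpace E]

/-- Finite differences of `u`, tested against their own direction, are controlled in `L¹` by `A`: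
the finite-difference form of a bound on the symmetrized gradient. -/
def LongitudinalBound (u : E → E) (A : ℝ≥0∞) : Prop :=
  ∀ h : E, ∫⁻ x, ‖inner ℝ h (u (x + h) - u x)‖ₑ ≤ ‖h‖ₑ ^ 2 * A

/-- Moving the translation onto `ψ`, the left side is the increment over `[0, 1]` of `t ↦ ∫ f(x) ψ(x
- t v) dx`. Translates of `ψ` are again admissible, so its derivative is bounded by `C` and the mean
value inequality applies. -/
lemma integral_sub_translate_mul_le {f : E → ℝ} (hf : Integrable f) {v : E} {C : ℝ}
    (h : ∀ ψ : E → ℝ, ContDiff ℝ 1 ψ → HasCompactSupport ψ → (∀ x, |ψ x| ≤ 1) →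
      |∫ x, f x * fderiv ℝ ψ x v| ≤ C)
    {ψ : E → ℝ} (hψ : ContDiff ℝ 1 ψ) (hψc : HasCompactSupport ψ) (hψ1 : ∀ x, |ψ x| ≤ 1) :
    ∫ x, (f (x + v) - f x) * ψ x ≤ C := by
  obtain ⟨M, hM⟩ := (hψc.fderiv (𝕜 := ℝ)).exists_bound_of_continuous
    (hψ.continuous_fderiv one_ne_zero)
  have hshift : ∀ t : ℝ, ContDiff ℝ 1 (fun x => ψ (x - t • v)) := fun t =>
    hψ.comp (contDiff_id.sub contDiff_const)
  have hint : ∀ t : ℝ, Integrable (fun x => f x * ψ (x - t • v)) := fun t =>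
    hf.mul_bdd (c := 1) (hshift t).continuous.aestronglyMeasurable
      (Eventually.of_forall fun x => hψ1 _)
  have hcomp : ∀ t : ℝ, HasCompactSupport (fun x => ψ (x - t • v)) := fun t =>
    hψc.comp_homeomorph (Homeomorph.subRight (t • v))
  have hderiv : ∀ t : ℝ, HasDerivAt (fun t : ℝ => ∫ x, f x * ψ (x - t • v))
      (∫ x, f x * fderiv ℝ ψ (x - t • v) (-v)) t := by
    intro t
    refine (hasDerivAt_integral_of_dominated_loc_of_deriv_le (s := univ)
      (F := fun t x => f x * ψ (x - t • v))
      (F' := fun t x => f x * fderiv ℝ ψ (x - t • v) (-v))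
      (bound := fun x => ‖f x‖ * (M * ‖v‖)) univ_mem
      (Eventually.of_forall fun t => (hint t).1) (hint t) ?_ ?_ (hf.norm.mul_const _) ?_).2
    · refine hf.1.mul (Continuous.aestronglyMeasurable ?_)
      exact ((hψ.continuous_fderiv one_ne_zero).comp (continuous_id.sub continuous_const)).clm_apply
        continuous_const
    · refine Eventually.of_forall fun x t _ => ?_
      rw [norm_mul]
      gcongr
      refine (ContinuousLinearMap.le_opNorm _ _).trans ?_
      rw [norm_neg]
      gcongr
      exact hM _
    · refine Eventually.of_forall fun x t _ => ?_
      have h1 : HasDerivAt (fun t : ℝ => x - t • v) (-v) t := by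
        simpa using ((hasDerivAt_id t).smul_const v).const_sub x
      exact (((hψ.differentiable one_ne_zero _).hasFDerivAt).comp_hasDerivAt t h1).const_mul (f x)
  have hbound : ∀ t : ℝ, ‖∫ x, f x * fderiv ℝ ψ (x - t • v) (-v)‖ ≤ C := by
    intro t
    have h1 := h _ (hshift t) (hcomp t) fun x => hψ1 _
    simp only [fderiv_comp_sub] at h1
    simpa [integral_neg] using h1
  have hmv := Convex.norm_image_sub_le_of_norm_hasDerivWithin_le (s := univ)
    (fun t _ => (hderiv t).hasDerivWithinAt) (fun t _ => hbound t) convex_univ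
    (mem_univ 0) (mem_univ 1)
  simp only [one_smul, zero_smul, sub_zero, norm_one, mul_one] at hmv
  refine le_trans (le_of_eq ?_) ((le_abs_self _).trans hmv)
  have h2 : ∫ x, f (x + v) * ψ x = ∫ x, f x * ψ (x - v) := by
    rw [← integral_add_right_eq_self (fun x => f x * ψ (x - v)) v]
    simp
  have h3 : Integrable (fun x => f (x + v) * ψ x) :=
    (hf.comp_add_right v).mul_bdd (c := 1) hψ.continuous.aestronglyMeasurable
      (Eventually.of_forall fun x => hψ1 _)
  have h4 : Integrable (fun x => f x * ψ x) := by simpa using hint 0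
  simp only [sub_mul]
  rw [integral_sub h3 h4, h2]

end Longitudinal

/-! ### Rank-one test fields for the total deformation -/

section Deformation

variable {n : ℕ}

local notation "𝔼" => EuclideanSpace ℝ (Fin n)

lemma rowDiv_smul_vecMulVec {ψ : 𝔼 → ℝ} (hψ : ContDiff ℝ 1 ψ) (v : 𝔼) (c : ℝ) (x : 𝔼) (i : Fin n) :
    rowDiv (fun y => (c * ψ y) • Matrix.vecMulVec v v) x i = c * v i * fderiv ℝ ψ x v := by
  have hv : v = ∑ j, v j • EuclideanSpace.single j (1 : ℝ) := by
    ext k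
    simp [Finset.sum_apply, Pi.single_apply]
  have hd : ∀ j : Fin n, fderiv ℝ (fun y => ((c * ψ y) • Matrix.vecMulVec v v) i j) x
      = (c * v i * v j) • fderiv ℝ ψ x := by
    intro j
    have : (fun y => ((c * ψ y) • Matrix.vecMulVec v v) i j) = fun y => (c * v i * v j) * ψ y := by
      ext y
      simp [Matrix.vecMulVec_apply]
      ring
    rw [this, fderiv_const_mul (hψ.differentiable one_ne_zero x)]
  rw [rowDiv]
  have hx : fderiv ℝ ψ x v = ∑ j, v j * fderiv ℝ ψ x (EuclideanSpace.single j 1) := by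
    conv_lhs => rw [hv]
    simp only [map_sum, map_smul, smul_eq_mul]
  simp only [hd, hx, Finset.mul_sum, smul_apply, smul_eq_mul]
  refine Finset.sum_congr rfl fun j _ => by ring

lemma sum_sq_vecMulVec (v : 𝔼) :
    ∑ i, ∑ j, (Matrix.vecMulVec v v i j) ^ 2 = (‖v‖ ^ 2) ^ 2 := by
  rw [EuclideanSpace.norm_sq_eq, sq (∑ i, _), Finset.sum_mul_sum]
  simp [Matrix.vecMulVec_apply, mul_pow]

/-- The test field is `ψ v ⊗ v / |v|²`: its Frobenius norm is `|ψ|`, and its row divergence is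
`|v|⁻² (∂ᵥψ) v`. -/
lemma integral_inner_mul_fderiv_le {u : 𝔼 → 𝔼} (hu : totalDeformation u < ⊤) (v : 𝔼) {ψ : 𝔼 → ℝ}
    (hψ : ContDiff ℝ 1 ψ) (hψc : HasCompactSupport ψ) (hψ1 : ∀ x, |ψ x| ≤ 1) :
    ∫ x, inner ℝ v (u x) * fderiv ℝ ψ x v ≤ ‖v‖ ^ 2 * (totalDeformation u).toReal := by
  rcases eq_or_ne v 0 with rfl | hv
  · simp
  have hv' : 0 < ‖v‖ := norm_pos_iff.2 hv
  set φ : 𝔼 → Matrix (Fin n) (Fin n) ℝ :=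
    fun y => ((‖v‖ ^ 2)⁻¹ * ψ y) • Matrix.vecMulVec v v with hφ
  have htest : IsDeformationTest φ := by
    refine ⟨fun i j => ?_, ?_, fun x => ?_, fun x => ?_⟩
    · simp only [hφ, Matrix.smul_apply, smul_eq_mul]
      exact (contDiff_const.mul hψ).mul contDiff_const
    · refine hψc.mono fun x hx => ?_
      contrapose! hx
      simp only [Function.mem_support, not_not] at hx ⊢
      simp [hφ, hx]
    · refine Matrix.IsSymm.smul ?_ _
      ext i j
      simp [Matrix.vecMulVec_apply, mul_comm]
    · have : ∑ i, ∑ j, (φ x i j) ^ 2 = ψ x ^ 2 := by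
        simp only [hφ, Matrix.smul_apply, smul_eq_mul, mul_pow _ (Matrix.vecMulVec _ _ _ _),
          ← Finset.mul_sum, sum_sq_vecMulVec]
        field_simp
      rw [this, Real.sqrt_sq_eq_abs]
      exact hψ1 x
  have h1 : ENNReal.ofReal (∫ x, ∑ i, u x i * rowDiv φ x i) ≤ totalDeformation u :=
    le_iSup₂_of_le φ htest le_rfl
  have h2 := (ENNReal.ofReal_le_iff_le_toReal hu.ne).1 h1
  have h3 : ∀ x, ∑ i, u x i * rowDiv φ x i
      = (‖v‖ ^ 2)⁻¹ * (inner ℝ v (u x) * fderiv ℝ ψ x v) := by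
    intro x
    simp only [hφ, rowDiv_smul_vecMulVec hψ, PiLp.inner_apply, Finset.mul_sum, Finset.sum_mul]
    refine Finset.sum_congr rfl fun i _ => ?_
    simp
    ring
  simp only [h3] at h2
  rw [integral_const_mul, inv_mul_le_iff₀ (by positivity)] at h2
  exact h2

/-- The total deformation bounds the longitudinal differences. -/
lemma MemBD.longitudinalBound {u : 𝔼 → 𝔼} (hu : MemBD u) :
    LongitudinalBound u (totalDeformation u) := by
  intro v
  have hT := hu.totalDeformation_lt_top
  have hf : Integrable fun x => inner ℝ v (u x) := hu.integrable.const_inner v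
  have key : ∀ ψ : 𝔼 → ℝ, ContDiff ℝ 1 ψ → HasCompactSupport ψ → (∀ x, |ψ x| ≤ 1) →
      ∫ x, (inner ℝ v (u (x + v)) - inner ℝ v (u x)) * ψ x
        ≤ ‖v‖ ^ 2 * (totalDeformation u).toReal := by
    intro ψ h1 h2 h3
    refine integral_sub_translate_mul_le hf (fun ψ h1 h2 h3 => abs_le.2 ⟨?_, ?_⟩) h1 h2 h3
    · have := integral_inner_mul_fderiv_le hT v (ψ := fun x => -ψ x) h1.neg h2.neg (by simpa using h3)
      simp only [fderiv_fun_neg, neg_apply, mul_neg, integral_neg] at this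
      linarith
    · exact integral_inner_mul_fderiv_le hT v h1 h2 h3
  have := lintegral_enorm_le_of_forall_contDiff ((hf.comp_add_right v).sub hf) key
  simp only [inner_sub_right]
  refine this.trans (le_of_eq ?_)
  rw [ENNReal.ofReal_mul (by positivity), ENNReal.ofReal_toReal hT.ne,
    ENNReal.ofReal_pow (norm_nonneg _), ofReal_norm]

end Deformation

/-! ### Stability of longitudinal bounds, and second differences -/

section Convolution

variable {E : Type*} [NormedAddCommGroup E] [InnerProductSpace ℝ E]
  [FiniteDimensional ℝ E] [MeasurableSpace E] [BorelSpace E]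

/-- Minkowski's integral inequality in `L¹`, by Tonelli: averaging against a probability density
preserves a bound uniform on its support. -/
lemma lintegral_le_of_enorm_le_lintegral {F G : Type*} [ENorm F] [NormedAddCommGroup G]
    {w : E → F} {k : E → ℝ} (hk : AEStronglyMeasurable k)
    (hk1 : ∫⁻ t, ‖k t‖ₑ = 1)
    {H : E → E → G} (hH : AEStronglyMeasurable (fun p : E × E => H p.1 p.2) (volume.prod volume))
    (hw : ∀ᵐ x, ‖w x‖ₑ ≤ ∫⁻ t, ‖k t‖ₑ * ‖H x t‖ₑ) {B : ℝ≥0∞}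
    (hB : ∀ t, k t ≠ 0 → ∫⁻ x, ‖H x t‖ₑ ≤ B) :
    ∫⁻ x, ‖w x‖ₑ ≤ B := by
  calc ∫⁻ x, ‖w x‖ₑ ≤ ∫⁻ x, ∫⁻ t, ‖k t‖ₑ * ‖H x t‖ₑ := lintegral_mono_ae hw
    _ = ∫⁻ t, ∫⁻ x, ‖k t‖ₑ * ‖H x t‖ₑ :=
        lintegral_lintegral_swap ((hk.comp_snd).enorm.mul hH.enorm)
    _ ≤ ∫⁻ t, ‖k t‖ₑ * B := by
        refine lintegral_mono fun t => ?_
        by_cases ht : k t = 0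
        · simp [ht]
        · rw [lintegral_const_mul' _ _ enorm_ne_top]
          gcongr
          exact hB t ht
    _ = B := by rw [lintegral_mul_const'' _ hk.enorm, hk1, one_mul]

lemma lintegral_enorm_eq_one {k : E → ℝ} (hk0 : ∀ t, 0 ≤ k t) (hk : Integrable k)
    (hk1 : ∫ t, k t = 1) : ∫⁻ t, ‖k t‖ₑ = 1 := by
  rw [← ofReal_integral_norm_eq_lintegral_enorm hk]
  simp [abs_of_nonneg (hk0 _), hk1]

lemma aestronglyMeasurable_comp_sub {G : Type*} [TopologicalSpace G] {u : E → G}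
    (hu : AEStronglyMeasurable u) :
    AEStronglyMeasurable (fun p : E × E => u (p.1 - p.2)) (volume.prod volume) :=
  hu.comp_quasiMeasurePreserving (quasiMeasurePreserving_sub_of_right_invariant _ _)

lemma aestronglyMeasurable_comp_add {G : Type*} [TopologicalSpace G] {u : E → G}
    (hu : AEStronglyMeasurable u) :
    AEStronglyMeasurable (fun p : E × E => u (p.1 + p.2)) (volume.prod volume) :=
  hu.comp_quasiMeasurePreserving
    (Measure.quasiMeasurePreserving_snd.comp
      (measurePreserving_prod_add volume volume).quasiMeasurePreserving)

lemma LongitudinalBound.convolve {u : E → E} {A : ℝ≥0∞} (hA : LongitudinalBound u A)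
    (hu : Integrable u) {k : E → ℝ} (hk0 : ∀ t, 0 ≤ k t) (hk : Integrable k)
    (hk1 : ∫ t, k t = 1) :
    LongitudinalBound (convolution k u (ContinuousLinearMap.lsmul ℝ ℝ) volume) A := by
  intro h
  have hd : Integrable (fun y => inner ℝ h (u (y + h) - u y)) :=
    ((hu.comp_add_right h).sub hu).const_inner h
  refine lintegral_le_of_enorm_le_lintegral hk.1 (lintegral_enorm_eq_one hk0 hk hk1)
    (H := fun x t => inner ℝ h (u (x - t + h) - u (x - t)))
    (aestronglyMeasurable_comp_sub hd.1) ?_ ?_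
  · have hex := hk.ae_convolution_exists (ContinuousLinearMap.lsmul ℝ ℝ) hu
    have hex' := (quasiMeasurePreserving_add_right volume h).ae hex
    filter_upwards [hex, hex'] with x h1 h2
    have h1' : Integrable fun t => k t • u (x - t) := h1
    have h2' : Integrable fun t => k t • u (x + h - t) := h2
    have : inner ℝ h (convolution k u (ContinuousLinearMap.lsmul ℝ ℝ) volume (x + h)
        - convolution k u (ContinuousLinearMap.lsmul ℝ ℝ) volume x)
        = ∫ t, k t * inner ℝ h (u (x - t + h) - u (x - t)) := by
      have hdi : Integrable fun t => k t • u (x + h - t) - k t • u (x - t) := h2'.sub h1'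
      simp only [convolution_def, ContinuousLinearMap.lsmul_apply]
      rw [← integral_sub h2' h1', ← integral_inner hdi]
      refine integral_congr_ae (Eventually.of_forall fun t => ?_)
      simp only [← smul_sub, inner_smul_right]
      rw [add_sub_right_comm]
    rw [this]
    refine (enorm_integral_le_lintegral_enorm _).trans (le_of_eq ?_)
    simp only [enorm_mul]
  · intro t _
    rw [lintegral_sub_right_eq_self (fun y => ‖inner ℝ h (u (y + h) - u y)‖ₑ) t]
    exact hA h

lemma LongitudinalBound.sub {u v : E → E} {A B : ℝ≥0∞} (hA : LongitudinalBound u A)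
    (hu : Integrable u) (hB : LongitudinalBound v B) :
    LongitudinalBound (fun x => u x - v x) (A + B) := by
  intro h
  have hm : AEStronglyMeasurable (fun x => inner ℝ h (u (x + h) - u x)) :=
    (((hu.comp_add_right h).sub hu).const_inner h).1
  calc ∫⁻ x, ‖inner ℝ h (u (x + h) - v (x + h) - (u x - v x))‖ₑ
      ≤ ∫⁻ x, (‖inner ℝ h (u (x + h) - u x)‖ₑ + ‖inner ℝ h (v (x + h) - v x)‖ₑ) := by
        refine lintegral_mono fun x => ?_
        rw [sub_sub_sub_comm, inner_sub_right]
        exact enorm_sub_le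
    _ = _ := lintegral_add_left' hm.enorm _
    _ ≤ ‖h‖ₑ ^ 2 * A + ‖h‖ₑ ^ 2 * B := add_le_add (hA h) (hB h)
    _ = _ := (mul_add _ _ _).symm

/-- Evaluating a second difference on an arbitrary vector `e` by longitudinal differences along the
bars of the framework with vertices `x ± h`, `x` and `x + e`. -/
lemma inner_second_difference {F : Type*} [NormedAddCommGroup F] [InnerProductSpace ℝ F]
    (u : F → F) (h e x : F) :
    inner ℝ e (u (x + h) + u (x - h) - (2 : ℝ) • u x) =
      2⁻¹ * inner ℝ ((2 : ℝ) • h) (u ((x - h) + (2 : ℝ) • h) - u (x - h))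
      - inner ℝ (h - e) (u ((x + e) + (h - e)) - u (x + e))
      - inner ℝ (-h - e) (u ((x + e) + (-h - e)) - u (x + e))
      + 2 * inner ℝ e (u (x + e) - u x) := by
  have e1 : (x - h) + (2 : ℝ) • h = x + h := by rw [two_smul]; abel
  have e2 : (x + e) + (h - e) = x + h := by abel
  have e3 : (x + e) + (-h - e) = x - h := by abel
  rw [e1, e2, e3]
  simp only [inner_sub_left, inner_sub_right, inner_add_right, inner_smul_left, inner_smul_right,
    inner_neg_left, RCLike.conj_to_real]
  ring

/-- As `|e| = |h|`, each bar of the framework has length at most `2|h|`. The terms of the identity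
contribute `2 + 4 + 4 + 2 = 12`. -/
lemma LongitudinalBound.lintegral_inner_second_difference_le {u : E → E} {A : ℝ≥0∞}
    (hA : LongitudinalBound u A) (hu : AEStronglyMeasurable u) {h e : E} (he : ‖e‖ = ‖h‖) :
    ∫⁻ x, ‖inner ℝ e (u (x + h) + u (x - h) - (2 : ℝ) • u x)‖ₑ ≤ 12 * ‖h‖ₑ ^ 2 * A := by
  have hm : ∀ w : E, AEMeasurable fun x => ‖inner ℝ w (u (x + w) - u x)‖ₑ := fun w =>
    ((((hu.comp_quasiMeasurePreserving (quasiMeasurePreserving_add_right volume w)).sub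
      hu).const_inner (c := w))).enorm
  have hm' : ∀ w a : E, AEMeasurable fun x => ‖inner ℝ w (u (x + a + w) - u (x + a))‖ₑ := fun w a =>
    (hm w).comp_quasiMeasurePreserving (quasiMeasurePreserving_add_right volume a)
  have hb : ∀ w a : E, ‖w‖ₑ ≤ 2 * ‖h‖ₑ →
      ∫⁻ x, ‖inner ℝ w (u (x + a + w) - u (x + a))‖ₑ ≤ 4 * ‖h‖ₑ ^ 2 * A := by
    intro w a hw
    rw [lintegral_add_right_eq_self (fun x => ‖inner ℝ w (u (x + w) - u x)‖ₑ) a]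
    refine (hA w).trans ?_
    gcongr
    calc ‖w‖ₑ ^ 2 ≤ (2 * ‖h‖ₑ) ^ 2 := by gcongr
      _ = 4 * ‖h‖ₑ ^ 2 := by ring
  have he' : ‖e‖ₑ = ‖h‖ₑ := by rw [← ofReal_norm, he, ofReal_norm]
  have b1 := hb ((2 : ℝ) • h) (-h) (by rw [enorm_smul]; simp [enorm_eq_nnnorm])
  have b2 := hb (h - e) e (by rw [two_mul]; exact enorm_sub_le.trans (by rw [he']))
  have b3 := hb (-h - e) e (by rw [two_mul]; exact enorm_sub_le.trans (by rw [he', enorm_neg]))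
  have b4 := hA e
  rw [he'] at b4
  calc ∫⁻ x, ‖inner ℝ e (u (x + h) + u (x - h) - (2 : ℝ) • u x)‖ₑ
      ≤ ∫⁻ x, (2⁻¹ * ‖inner ℝ ((2 : ℝ) • h) (u (x + -h + (2 : ℝ) • h) - u (x + -h))‖ₑ
        + ‖inner ℝ (h - e) (u ((x + e) + (h - e)) - u (x + e))‖ₑ
        + ‖inner ℝ (-h - e) (u ((x + e) + (-h - e)) - u (x + e))‖ₑ
        + 2 * ‖inner ℝ e (u (x + e) - u x)‖ₑ) := by
        refine lintegral_mono fun x => ?_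
        rw [inner_second_difference, sub_eq_add_neg x h]
        refine (enorm_add_le _ _).trans (add_le_add (enorm_sub_le.trans
          (add_le_add (enorm_sub_le.trans (add_le_add ?_ le_rfl)) le_rfl)) ?_)
        · rw [enorm_mul]
          gcongr
          rw [← ofReal_norm, norm_inv, ENNReal.ofReal_inv_of_pos (by norm_num)]
          simp
        · rw [enorm_mul]
          simp [enorm_eq_nnnorm]
    _ ≤ 2⁻¹ * (4 * ‖h‖ₑ ^ 2 * A) + 4 * ‖h‖ₑ ^ 2 * A + 4 * ‖h‖ₑ ^ 2 * A + 2 * (‖h‖ₑ ^ 2 * A) := by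
        rw [lintegral_add_right' _ ((hm _).const_mul _), lintegral_add_right' _ (hm' _ _),
          lintegral_add_right' _ (hm' _ _),
          lintegral_const_mul'' _ (hm' _ _), lintegral_const_mul'' _ (hm _)]
        gcongr
    _ = 12 * ‖h‖ₑ ^ 2 * A := by
        have : (2⁻¹ : ℝ≥0∞) * 4 = 2 := by
          rw [show (4 : ℝ≥0∞) = 2 * 2 by norm_num, ← mul_assoc,
            ENNReal.inv_mul_cancel (by norm_num) (by norm_num), one_mul]
        rw [← mul_assoc, ← mul_assoc, this]
        ring

end Convolution

/-! ### `L¹` distance to an even mollification -/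

section Euclidean

variable {n : ℕ}

local notation "𝔼" => EuclideanSpace ℝ (Fin n)

lemma EuclideanSpace.enorm_le_sum (y : 𝔼) : ‖y‖ₑ ≤ ∑ j, ‖y j‖ₑ := by
  have hy : y = ∑ j, y j • EuclideanSpace.single j (1 : ℝ) := by
    ext k
    simp [Finset.sum_apply, Pi.single_apply]
  calc ‖y‖ₑ = ‖∑ j, y j • EuclideanSpace.single j (1 : ℝ)‖ₑ := by rw [← hy]
    _ ≤ ∑ j, ‖y j • EuclideanSpace.single j (1 : ℝ)‖ₑ := enorm_sum_le _ _
    _ = ∑ j, ‖y j‖ₑ := by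
      refine Finset.sum_congr rfl fun j _ => ?_
      rw [enorm_smul]
      simp [enorm_eq_nnnorm]

lemma LongitudinalBound.lintegral_second_difference_le {u : 𝔼 → 𝔼} {A : ℝ≥0∞}
    (hA : LongitudinalBound u A) (hu : AEStronglyMeasurable u) (h : 𝔼) :
    ∫⁻ x, ‖u (x + h) + u (x - h) - (2 : ℝ) • u x‖ₑ ≤ 12 * n * ‖h‖ₑ * A := by
  rcases eq_or_ne h 0 with rfl | hh
  · simp [two_smul]
  have hm : AEStronglyMeasurable fun x => u (x + h) + u (x - h) - (2 : ℝ) • u x :=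
    ((hu.comp_quasiMeasurePreserving (quasiMeasurePreserving_add_right volume h)).add
      (hu.comp_quasiMeasurePreserving (measurePreserving_sub_right volume h).quasiMeasurePreserving)).sub
      (hu.fun_const_smul 2)
  have h0 : ‖h‖ₑ ≠ 0 := by simpa using hh
  have hj : ∀ j : Fin n, ∫⁻ x, ‖(u (x + h) + u (x - h) - (2 : ℝ) • u x) j‖ₑ ≤ 12 * ‖h‖ₑ * A := by
    intro j
    have := hA.lintegral_inner_second_difference_le hu (h := h)
      -- Coordinate vectors are rescaled to the length of `h`; one factor `‖h‖` is cancelled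
      -- afterwards.
      (e := ‖h‖ • EuclideanSpace.single j (1 : ℝ)) (by rw [norm_smul]; simp)
    simp only [inner_smul_left, EuclideanSpace.inner_single_left, RCLike.conj_to_real, enorm_mul,
      map_one, one_mul, enorm_norm] at this
    rw [lintegral_const_mul' _ _ enorm_ne_top] at this
    rw [← ENNReal.mul_le_mul_iff_right h0 enorm_ne_top]
    refine this.trans (le_of_eq ?_)
    ring
  calc ∫⁻ x, ‖u (x + h) + u (x - h) - (2 : ℝ) • u x‖ₑ
      ≤ ∫⁻ x, ∑ j, ‖(u (x + h) + u (x - h) - (2 : ℝ) • u x) j‖ₑ :=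
        lintegral_mono fun x => EuclideanSpace.enorm_le_sum _
    _ = ∑ j, ∫⁻ x, ‖(u (x + h) + u (x - h) - (2 : ℝ) • u x) j‖ₑ := by
        refine lintegral_finsetSum' _ fun j _ => ?_
        exact ((EuclideanSpace.proj (𝕜 := ℝ) j).continuous.comp_aestronglyMeasurable hm).enorm
    _ ≤ ∑ j : Fin n, 12 * ‖h‖ₑ * A := Finset.sum_le_sum fun j _ => hj j
    _ = 12 * n * ‖h‖ₑ * A := by simp; ring

/-- Convolution with an even probability density supported in the ball of radius `ε` moves `u` by
at most a multiple of `ε` in `L¹`. -/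
lemma LongitudinalBound.lintegral_sub_convolution_le {u : 𝔼 → 𝔼} {A : ℝ≥0∞}
    (hA : LongitudinalBound u A) (hu : Integrable u) {k : 𝔼 → ℝ} (hk0 : ∀ t, 0 ≤ k t)
    (hk : Integrable k) (hk1 : ∫ t, k t = 1) (heven : ∀ t, k (-t) = k t) {ε : ℝ}
    (hsupp : ∀ t, k t ≠ 0 → ‖t‖ ≤ ε) :
    ∫⁻ x, ‖u x - convolution k u (ContinuousLinearMap.lsmul ℝ ℝ) volume x‖ₑ
      ≤ 12 * n * ENNReal.ofReal ε * A := by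
  refine lintegral_le_of_enorm_le_lintegral hk.1 (lintegral_enorm_eq_one hk0 hk hk1)
    (H := fun x t => u (x + t) + u (x - t) - (2 : ℝ) • u x) ?_ ?_ ?_
  · exact ((aestronglyMeasurable_comp_add hu.1).add (aestronglyMeasurable_comp_sub hu.1)).sub
      (hu.1.comp_fst.fun_const_smul 2)
  · filter_upwards [hk.ae_convolution_exists (ContinuousLinearMap.lsmul ℝ ℝ) hu] with x hx
    have h1 : Integrable fun t => k t • u (x - t) := hx
    have h2 : Integrable fun t => k t • u (x + t) := by
      simpa [heven] using h1.comp_neg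
    have h3 : ∫ t, k t • u (x + t) = ∫ t, k t • u (x - t) := by
      rw [← integral_neg_eq_self]
      simp [heven, sub_eq_add_neg]
    have h4 : ∫ t, k t • u x = u x := by rw [integral_smul_const, hk1, one_smul]
    have h5 : Integrable fun t => k t • u x := hk.smul_const _
    -- Evenness makes both one-sided averages equal to the convolution, and unit mass reproduces `u
    -- x`. The gain of the factor 2 is discarded below.
    have key : ∫ t, k t • (u (x + t) + u (x - t) - (2 : ℝ) • u x)
        = (-2 : ℝ) • (u x - convolution k u (ContinuousLinearMap.lsmul ℝ ℝ) volume x) := by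
      simp only [smul_sub, smul_add, convolution_def, ContinuousLinearMap.lsmul_apply]
      simp only [smul_comm (k _) (2 : ℝ)]
      have h6 : Integrable fun t => k t • u (x + t) + k t • u (x - t) := h2.add h1
      have h7 : Integrable fun t => (2 : ℝ) • k t • u x := h5.smul (2 : ℝ)
      rw [integral_sub h6 h7, integral_add h2 h1, h3, integral_smul, h4,
        neg_smul, neg_smul, ← two_smul ℝ]
      abel
    calc ‖u x - convolution k u (ContinuousLinearMap.lsmul ℝ ℝ) volume x‖ₑ
        ≤ ‖(-2 : ℝ) • (u x - convolution k u (ContinuousLinearMap.lsmul ℝ ℝ) volume x)‖ₑ := by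
          rw [enorm_smul]
          refine le_mul_of_one_le_left' ?_
          rw [enorm_neg]
          simp [enorm_eq_nnnorm]
      _ ≤ _ := by
          rw [← key]
          refine (enorm_integral_le_lintegral_enorm _).trans (le_of_eq ?_)
          simp only [enorm_smul]
  · intro t ht
    refine (hA.lintegral_second_difference_le hu.1 t).trans ?_
    gcongr
    rw [← ofReal_norm]
    exact ENNReal.ofReal_le_ofReal (hsupp t ht)

end Euclidean

/-! ### Line integrals and smooth approximation -/

section Lines

lemma tendsto_line_cocompact {E : Type*} [NormedAddCommGroup E] [NormedSpace ℝ E]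
    [FiniteDimensional ℝ E] (x : E) {ξ : E} (hξ : ξ ≠ 0) :
    Tendsto (fun t : ℝ => x + t • ξ) atTop (cocompact E) := by
  have : ProperSpace E := FiniteDimensional.proper ℝ E
  rw [← cobounded_eq_cocompact, ← tendsto_norm_atTop_iff_cobounded]
  have h1 : Tendsto (fun t : ℝ => t * ‖ξ‖ - ‖x‖) atTop atTop :=
    tendsto_atTop_add_const_right _ _ (tendsto_id.atTop_mul_const (norm_pos_iff.2 hξ))
  refine tendsto_atTop_mono (fun t => ?_) h1
  have h2 : ‖t • ξ‖ ≤ ‖x + t • ξ‖ + ‖x‖ := by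
    simpa using norm_sub_le (x + t • ξ) x
  rw [norm_smul] at h2
  have h3 : t * ‖ξ‖ ≤ ‖t‖ * ‖ξ‖ := by
    gcongr
    exact Real.le_norm_self t
  linarith

lemma enorm_le_lintegral_of_hasDerivAt_of_tendsto_zero {F : Type*} [NormedAddCommGroup F]
    [NormedSpace ℝ F] [CompleteSpace F] {g g' : ℝ → F} (hg : ∀ t, HasDerivAt g (g' t) t)
    (hg' : Continuous g') (h0 : Tendsto g atTop (𝓝 0)) : ‖g 0‖ₑ ≤ ∫⁻ t, ‖g' t‖ₑ := by
  by_cases hfin : ∫⁻ t, ‖g' t‖ₑ = ⊤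
  · simp [hfin]
  have hint : Integrable g' := ⟨hg'.aestronglyMeasurable, lt_top_iff_ne_top.2 hfin⟩
  have h1 := integral_Ioi_of_hasDerivAt_of_tendsto' (a := 0) (fun t _ => hg t)
    hint.integrableOn h0
  rw [zero_sub] at h1
  calc ‖g 0‖ₑ = ‖∫ t in Ioi 0, g' t‖ₑ := by rw [h1, enorm_neg]
    _ ≤ ∫⁻ t in Ioi 0, ‖g' t‖ₑ := enorm_integral_le_lintegral_enorm _
    _ ≤ ∫⁻ t, ‖g' t‖ₑ := setLIntegral_le_lintegral _ _

lemma enorm_inner_le_lintegral_line {E : Type*} [NormedAddCommGroup E]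
    [InnerProductSpace ℝ E] {w : E → E} (hw : ContDiff ℝ 1 w) {ξ : E}
    {x : E} (h0 : Tendsto (fun t : ℝ => w (x + t • ξ)) atTop (𝓝 0)) :
    ‖inner ℝ ξ (w x)‖ₑ ≤ ∫⁻ t : ℝ, ‖inner ℝ ξ (fderiv ℝ w (x + t • ξ) ξ)‖ₑ := by
  have hline : Continuous fun t : ℝ => x + t • ξ := by fun_prop
  have := enorm_le_lintegral_of_hasDerivAt_of_tendsto_zero
    (g := fun t : ℝ => inner ℝ ξ (w (x + t • ξ)))
    (g' := fun t : ℝ => inner ℝ ξ (fderiv ℝ w (x + t • ξ) ξ)) (fun t => ?_) ?_ ?_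
  · simpa using this
  · have h2 : HasDerivAt (fun t : ℝ => x + t • ξ) ξ t := by
      simpa using ((hasDerivAt_id t).smul_const ξ).const_add x
    have h3 := ((hw.differentiable one_ne_zero (x + t • ξ)).hasFDerivAt).comp_hasDerivAt t h2
    simpa using (hasDerivAt_const t ξ).inner ℝ h3
  · exact continuous_const.inner
      (((hw.continuous_fderiv one_ne_zero).comp hline).clm_apply continuous_const)
  · simpa using (tendsto_const_nhds (x := ξ)).inner (𝕜 := ℝ) h0

variable {E : Type*} [NormedAddCommGroup E] [InnerProductSpace ℝ E]
  [FiniteDimensional ℝ E] [MeasurableSpace E] [BorelSpace E]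

/-- Supplies the vanishing at infinity needed to integrate a derivative along a line; integrability
of `f` alone would not give it on every line. -/
lemma tendsto_convolution_line_zero {F : Type*} [NormedAddCommGroup F] [NormedSpace ℝ F]
    {φ : E → ℝ} (hφ : Continuous φ) (hφc : HasCompactSupport φ) {f : E → F} (hf : Integrable f)
    (x : E) {ξ : E} (hξ : ξ ≠ 0) :
    Tendsto (fun t : ℝ => convolution φ f (ContinuousLinearMap.lsmul ℝ ℝ) volume (x + t • ξ))
      atTop (𝓝 0) := by
  obtain ⟨M, hM⟩ := hφc.exists_bound_of_continuous hφ
  simp only [convolution_lsmul_swap]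
  have h0 : (0 : F) = ∫ _ : E, (0 : F) := by simp
  rw [h0]
  refine tendsto_integral_filter_of_dominated_convergence (fun z => M * ‖f z‖)
    (Eventually.of_forall fun t => ?_) (Eventually.of_forall fun t => Eventually.of_forall fun z => ?_)
    (hf.norm.const_mul M) (Eventually.of_forall fun z => ?_)
  · exact (hφ.comp (continuous_const.sub continuous_id)).aestronglyMeasurable.smul hf.1
  · rw [norm_smul]
    gcongr
    exact hM _
  · have h1 : Tendsto (fun t : ℝ => φ (x + t • ξ - z)) atTop (𝓝 0) := by
      simp only [add_sub_right_comm]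
      exact hφc.is_zero_at_infty.comp (tendsto_line_cocompact (x - z) hξ)
    simpa using h1.smul_const (f z)

/-- Fatou's lemma turns the bound on longitudinal differences into one on longitudinal
derivatives. -/
lemma LongitudinalBound.lintegral_inner_fderiv_le {w : E → E} {A : ℝ≥0∞}
    (hA : LongitudinalBound w A) (hw : ContDiff ℝ 1 w) (ξ : E) :
    ∫⁻ x, ‖inner ℝ ξ (fderiv ℝ w x ξ)‖ₑ ≤ ‖ξ‖ₑ ^ 2 * A := by
  set τ : ℕ → ℝ := fun m => 1 / ((m : ℝ) + 1) with hτ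
  have hτ0 : ∀ m, 0 < τ m := fun m => by positivity
  have hτlim : Tendsto τ atTop (𝓝[≠] 0) :=
    tendsto_nhdsWithin_iff.2 ⟨tendsto_one_div_add_atTop_nhds_zero_nat,
      Eventually.of_forall fun m => (hτ0 m).ne'⟩
  set D : ℕ → E → ℝ≥0∞ := fun m x => ‖(τ m)⁻¹ * inner ℝ ξ (w (x + τ m • ξ) - w x)‖ₑ with hD
  have hlim : ∀ x, Tendsto (fun m => D m x) atTop (𝓝 ‖inner ℝ ξ (fderiv ℝ w x ξ)‖ₑ) := by
    intro x
    have h1 : HasDerivAt (fun t : ℝ => w (x + t • ξ)) (fderiv ℝ w x ξ) 0 := by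
      have h2 : HasDerivAt (fun t : ℝ => x + t • ξ) ξ 0 := by
        simpa using ((hasDerivAt_id (0 : ℝ)).smul_const ξ).const_add x
      have h3 : HasFDerivAt w (fderiv ℝ w x) (x + (0 : ℝ) • ξ) := by
        simpa using (hw.differentiable one_ne_zero x).hasFDerivAt
      exact h3.comp_hasDerivAt 0 h2
    have h4 := (hasDerivAt_iff_tendsto_slope_zero.1 h1).comp hτlim
    have h5 := ((tendsto_const_nhds (x := ξ)).inner (𝕜 := ℝ) h4).enorm
    refine h5.congr fun m => ?_
    simp [hD, inner_smul_right]
  have hbound : ∀ m, ∫⁻ x, D m x ≤ ‖ξ‖ₑ ^ 2 * A := by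
    intro m
    have h1 := hA (τ m • ξ)
    -- One factor `(τ m)⁻¹` is the difference quotient; the other compensates for replacing `ξ` by
    -- `τ m • ξ`. This matches the quadratic scaling of the bound.
    have h2 : ∀ x, D m x = ‖(τ m)⁻¹‖ₑ ^ 2 * ‖inner ℝ (τ m • ξ) (w (x + τ m • ξ) - w x)‖ₑ := by
      intro x
      simp only [hD, inner_smul_left, RCLike.conj_to_real]
      rw [sq, ← enorm_mul, ← enorm_mul]
      congr 1
      field_simp [(hτ0 m).ne']
    simp only [h2]
    rw [lintegral_const_mul' _ _ (ENNReal.pow_ne_top enorm_ne_top)]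
    calc _ ≤ ‖(τ m)⁻¹‖ₑ ^ 2 * (‖τ m • ξ‖ₑ ^ 2 * A) := by gcongr
      _ = ‖ξ‖ₑ ^ 2 * A := by
        rw [← mul_assoc, ← mul_pow, ← enorm_smul, smul_smul, inv_mul_cancel₀ (hτ0 m).ne', one_smul]
  calc ∫⁻ x, ‖inner ℝ ξ (fderiv ℝ w x ξ)‖ₑ
      = ∫⁻ x, liminf (fun m => D m x) atTop := by simp only [(hlim _).liminf_eq]
    _ ≤ liminf (fun m => ∫⁻ x, D m x) atTop := by
        refine lintegral_liminf_le fun m => ?_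
        have : Continuous fun x => (τ m)⁻¹ * inner ℝ ξ (w (x + τ m • ξ) - w x) :=
          continuous_const.mul (continuous_const.inner
            ((hw.continuous.comp (continuous_id.add continuous_const)).sub hw.continuous))
        exact this.measurable.enorm
    _ ≤ liminf (fun _ => ‖ξ‖ₑ ^ 2 * A) (atTop : Filter ℕ) :=
        liminf_le_liminf (Eventually.of_forall hbound)
    _ = ‖ξ‖ₑ ^ 2 * A := liminf_const _

/-- Smooth approximations of a function satisfying a longitudinal bound, with the properties
needed for inequalities of Gagliardo–Nirenberg type. -/
lemma LongitudinalBound.exists_smooth_approx {v : E → E} {A : ℝ≥0∞}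
    (hA : LongitudinalBound v A) (hv : Integrable v) :
    ∃ w : ℕ → E → E, (∀ k, ContDiff ℝ 1 (w k)) ∧
      (∀ k ξ, ∫⁻ x, ‖inner ℝ ξ (fderiv ℝ (w k) x ξ)‖ₑ ≤ ‖ξ‖ₑ ^ 2 * A) ∧
      (∀ k x ξ, ‖inner ℝ ξ (w k x)‖ₑ ≤
        ∫⁻ t : ℝ, ‖inner ℝ ξ (fderiv ℝ (w k) (x + t • ξ) ξ)‖ₑ) ∧
      ∀ᵐ x, Tendsto (fun k => w k x) atTop (𝓝 (v x)) := by
  have hcd : ∀ k, ContDiff ℝ 1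
      (convolution (approxIdentity E k) v (ContinuousLinearMap.lsmul ℝ ℝ) volume) := fun k =>
    (approxIdentity_hasCompactSupport k).contDiff_convolution_left (n := 1) _
      (approxIdentity_contDiff k) hv.locallyIntegrable
  refine ⟨fun k => convolution (approxIdentity E k) v (ContinuousLinearMap.lsmul ℝ ℝ) volume,
    hcd, fun k ξ => ?_, fun k x ξ => ?_, ae_tendsto_approxIdentity_convolution hv.locallyIntegrable⟩
  · exact (hA.convolve hv (approxIdentity_nonneg k) (approxIdentity_integrable k)
      (integral_approxIdentity k)).lintegral_inner_fderiv_le (hcd k) ξ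
  · rcases eq_or_ne ξ 0 with rfl | hξ
    · simp
    · exact enorm_inner_le_lintegral_line (hcd k) (tendsto_convolution_line_zero
        (approxIdentity_contDiff (m := 0) k).continuous (approxIdentity_hasCompactSupport k) hv x hξ)

end Lines

/-! ### Linear changes of variables -/

section ChangeOfVariables

/-- The image of Lebesgue measure is a Haar measure, hence a multiple of the volume by uniqueness;
only `0 < c < ∞` matters here. -/
lemma ContinuousLinearEquiv.exists_lintegral_comp_eq {V E : Type*} [NormedAddCommGroup V]
    [NormedSpace ℝ V] [MeasureSpace V] [BorelSpace V]
    [(volume : Measure V).IsAddHaarMeasure]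
    [NormedAddCommGroup E] [InnerProductSpace ℝ E] [FiniteDimensional ℝ E] [MeasurableSpace E]
    [BorelSpace E] (L : V ≃L[ℝ] E) :
    ∃ c : ℝ≥0∞, c ≠ 0 ∧ c ≠ ⊤ ∧ ∀ F : E → ℝ≥0∞, ∫⁻ t, F (L t) = c * ∫⁻ x, F x := by
  set μ : Measure E := Measure.map L volume
  refine ⟨Measure.addHaarScalarFactor μ volume, ?_, ENNReal.coe_ne_top, fun F => ?_⟩
  · exact_mod_cast (Measure.addHaarScalarFactor_pos_of_isAddHaarMeasure μ volume).ne'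
  · have h1 : ∫⁻ x, F x ∂μ = ∫⁻ t, F (L t) :=
      lintegral_map_equiv F L.toHomeomorph.toMeasurableEquiv
    have h2 : ∫⁻ x, F x ∂μ = ∫⁻ x, F x ∂(Measure.addHaarScalarFactor μ volume • volume) := by
      conv_lhs => rw [Measure.isAddLeftInvariant_eq_smul μ volume]
    rw [← h1, h2, lintegral_smul_measure]
    rfl

end ChangeOfVariables

/-! ### Gagliardo–Nirenberg in oblique coordinates -/

section GagliardoNirenberg

variable {n : ℕ}

local notation "𝔼" => EuclideanSpace ℝ (Fin n)

/-- The Gagliardo–Nirenberg inequality in oblique coordinates. -/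
lemma exists_lintegral_prod_le (hn : 2 ≤ n) {ξ : Fin n → 𝔼} (hξ : LinearIndependent ℝ ξ) :
    ∃ C : ℝ≥0∞, C ≠ ⊤ ∧ ∀ (f g : Fin n → 𝔼 → ℝ≥0∞) (B : ℝ≥0∞), (∀ i, Measurable (g i)) →
      (∀ i x, f i x ≤ ∫⁻ t : ℝ, g i (x + t • ξ i)) → (∀ i, ∫⁻ x, g i x ≤ B) →
      ∫⁻ x, ∏ i, f i x ^ ((1 : ℝ) / ((n : ℝ) - 1)) ≤ C * B ^ ((n : ℝ) / ((n : ℝ) - 1)) := by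
  have : Nonempty (Fin n) := ⟨⟨0, by omega⟩⟩
  have hn' : (1 : ℝ) < n := by exact_mod_cast hn
  set p : ℝ := (n : ℝ) / ((n : ℝ) - 1) with hp
  have hp0 : 0 ≤ p := div_nonneg (by linarith) (by linarith)
  have hconj : Real.HolderConjugate (Fintype.card (Fin n)) p := by
    rw [Fintype.card_fin]
    exact Real.HolderConjugate.conjExponent hn'
  let b : Module.Basis (Fin n) ℝ 𝔼 := basisOfLinearIndependentOfCardEqFinrank hξ (by simp)
  have hb : ∀ i, b i = ξ i := fun i => by simp [b]
  let L : (Fin n → ℝ) ≃L[ℝ] 𝔼 := b.equivFunL.symm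
  have hL : ∀ (t : Fin n → ℝ) (i : Fin n) (s : ℝ),
      L (Function.update t i (t i + s)) = L t + s • ξ i := by
    intro t i s
    have h1 : Function.update t i (t i + s) = t + s • Pi.single i 1 := by
      ext j
      rcases eq_or_ne j i with rfl | hj
      · simp
      · simp [hj]
    have h2 : L (Pi.single i 1) = ξ i := by
      rw [← hb]
      change b.equivFun.symm _ = _
      simp [Module.Basis.equivFun_symm_apply, Pi.single_apply]
    rw [h1, map_add, map_smul, h2]
  obtain ⟨c, hc0, hct, hc⟩ := L.exists_lintegral_comp_eq
  refine ⟨c⁻¹ * (c * n) ^ p, ?_, fun f g B hg hfg hB => ?_⟩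
  · exact ENNReal.mul_ne_top (ENNReal.inv_ne_top.2 hc0)
      (ENNReal.rpow_ne_top_of_nonneg hp0 (ENNReal.mul_ne_top hct (ENNReal.natCast_ne_top n)))
  -- The grid-lines inequality takes a single function, so all `g i` are replaced by their sum; this
  -- costs the factor `n`.
  set G : (Fin n → ℝ) → ℝ≥0∞ := fun t => ∑ i, g i (L t) with hG
  have hGm : Measurable G :=
    Finset.measurable_fun_sum _ fun i _ => (hg i).comp L.continuous.measurable
  have hfG : ∀ t i, f i (L t) ≤ ∫⁻ s : ℝ, G (Function.update t i s) := by
    intro t i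
    calc f i (L t) ≤ ∫⁻ s : ℝ, g i (L t + s • ξ i) := hfg i _
      _ = ∫⁻ s : ℝ, g i (L (Function.update t i (t i + s))) := by simp only [hL]
      _ = ∫⁻ s : ℝ, g i (L (Function.update t i s)) :=
          lintegral_add_left_eq_self (fun s => g i (L (Function.update t i s))) (t i)
      _ ≤ ∫⁻ s : ℝ, G (Function.update t i s) := lintegral_mono fun s =>
          Finset.single_le_sum (f := fun j => g j (L (Function.update t i s)))
            (fun _ _ => zero_le) (Finset.mem_univ i)
  have hGN := lintegral_prod_lintegral_pow_le (fun _ : Fin n => (volume : Measure ℝ)) hconj hGm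
  rw [Fintype.card_fin, ← volume_pi] at hGN
  have hGint : ∫⁻ t, G t ≤ c * n * B := by
    have hsum : ∫⁻ t, G t = ∑ i, ∫⁻ t, g i (L t) :=
      lintegral_finsetSum _ fun i _ => (hg i).comp L.continuous.measurable
    rw [hsum]
    calc ∑ i, ∫⁻ t, g i (L t) = ∑ i, c * ∫⁻ x, g i x := by simp only [hc]
      _ ≤ ∑ i : Fin n, c * B := by gcongr with i; exact hB i
      _ = c * n * B := by simp; ring
  have hmain : c * ∫⁻ x, ∏ i, f i x ^ ((1 : ℝ) / ((n : ℝ) - 1)) ≤ (c * n * B) ^ p := by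
    rw [← hc]
    refine le_trans (lintegral_mono fun t => ?_) (hGN.trans (ENNReal.rpow_le_rpow hGint hp0))
    refine Finset.prod_le_prod' fun i _ => ENNReal.rpow_le_rpow (hfG t i) ?_
    exact div_nonneg zero_le_one (by linarith)
  rw [mul_assoc, ← ENNReal.mul_rpow_of_nonneg _ _ hp0]
  calc ∫⁻ x, ∏ i, f i x ^ ((1 : ℝ) / ((n : ℝ) - 1))
      = c⁻¹ * (c * ∫⁻ x, ∏ i, f i x ^ ((1 : ℝ) / ((n : ℝ) - 1))) := by
        rw [← mul_assoc, ENNReal.inv_mul_cancel hc0 hct, one_mul]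
    _ ≤ c⁻¹ * (c * n * B) ^ p := by gcongr

end GagliardoNirenberg

/-! ### Directions in general position -/

section MomentCurve

/-- Points on the moment curve, any `n` of which are linearly independent. -/
noncomputable def momentVector (n : ℕ) (k : ℕ) : EuclideanSpace ℝ (Fin n) :=
  WithLp.toLp 2 fun j : Fin n => (k : ℝ) ^ (j : ℕ)

variable {n : ℕ}

local notation "𝔼" => EuclideanSpace ℝ (Fin n)

lemma linearIndependent_momentVector {e : Fin n → ℕ} (he : Function.Injective e) :
    LinearIndependent ℝ fun i => momentVector n (e i) := by
  have h1 : (Matrix.vandermonde fun i => (e i : ℝ)).det ≠ 0 :=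
    Matrix.det_vandermonde_ne_zero_iff.2 (Nat.cast_injective.comp he)
  have h2 := Matrix.linearIndependent_rows_of_det_ne_zero h1
  exact h2.map' (WithLp.linearEquiv 2 ℝ (Fin n → ℝ)).symm.toLinearMap (LinearEquiv.ker _)

/-- The map `y ↦ (ξᵢ · y)ᵢ` is injective, hence bounded below in finite dimension; `i` is chosen to
maximise the component. -/
lemma exists_norm_le_mul_abs_inner (hn : 1 ≤ n) {ξ : Fin n → 𝔼} (hξ : LinearIndependent ℝ ξ) :
    ∃ K : ℝ, 0 ≤ K ∧ ∀ y : 𝔼, ∃ i, ‖y‖ ≤ K * |inner ℝ (ξ i) y| := by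
  have : Nonempty (Fin n) := ⟨⟨0, hn⟩⟩
  let b : Module.Basis (Fin n) ℝ 𝔼 := basisOfLinearIndependentOfCardEqFinrank hξ (by simp)
  have hb : ∀ i, b i = ξ i := fun i => by simp [b]
  let T : 𝔼 →ₗ[ℝ] (Fin n → ℝ) := LinearMap.pi fun i => (innerSL ℝ (ξ i)).toLinearMap
  have hT : ∀ y i, T y i = inner ℝ (ξ i) y := fun y i => rfl
  have hker : LinearMap.ker T = ⊥ := by
    refine LinearMap.ker_eq_bot'.2 fun y hy => ?_
    have h1 : (innerₗ 𝔼).flip y = 0 := b.ext fun i => by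
      have := congrFun hy i
      rw [hT] at this
      simpa [hb, real_inner_comm] using this
    exact inner_self_eq_zero.1 (LinearMap.congr_fun h1 y)
  obtain ⟨K, -, hK⟩ := T.exists_antilipschitzWith hker
  refine ⟨K, K.2, fun y => ?_⟩
  have h1 : ‖y‖ ≤ K * ‖T y‖ := by simpa using hK.le_mul_dist y 0
  obtain ⟨i, hi⟩ := Finite.exists_max fun i => ‖T y i‖
  refine ⟨i, h1.trans ?_⟩
  gcongr
  exact (pi_norm_le_iff_of_nonneg (abs_nonneg _)).2 hi

/-- A vector has at least `n` components of comparable size among its components in `2n - 1`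
directions in general position. -/
lemma exists_embedding_norm_le (hn : 1 ≤ n) :
    ∃ K : ℝ, 0 ≤ K ∧ ∀ y : 𝔼, ∃ e : Fin n ↪ Fin (2 * n - 1), ∀ i,
      ‖y‖ ≤ K * |inner ℝ (momentVector n (e i)) y| := by
  have hinj : ∀ e : Fin n ↪ Fin (2 * n - 1), Function.Injective fun i => (e i : ℕ) := fun e =>
    Fin.val_injective.comp e.injective
  choose K hK0 hK using fun e : Fin n ↪ Fin (2 * n - 1) =>
    exists_norm_le_mul_abs_inner hn (linearIndependent_momentVector (hinj e))
  refine ⟨∑ e, K e, Finset.sum_nonneg fun e _ => hK0 e, fun y => ?_⟩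
  classical
  set J : Finset (Fin (2 * n - 1)) := Finset.univ.filter fun k =>
    ‖y‖ ≤ (∑ e, K e) * |inner ℝ (momentVector n k) y| with hJ
  have hcard : n ≤ J.card := by
    -- With fewer than `n` good directions out of `2n - 1`, at least `n` are bad. These form a
    -- basis, one of whose components must be large: a contradiction.
    by_contra! hlt
    have hc : n ≤ Jᶜ.card := by
      rw [Finset.card_compl, Fintype.card_fin]
      omega
    let e := (Jᶜ.orderEmbOfCardLe hc).toEmbedding
    obtain ⟨i, hi⟩ := hK e y
    have hmem : e i ∈ Jᶜ := Jᶜ.orderEmbOfCardLe_mem hc i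
    rw [Finset.mem_compl] at hmem
    refine hmem (Finset.mem_filter.2 ⟨Finset.mem_univ _, hi.trans ?_⟩)
    gcongr
    exact Finset.single_le_sum (fun e _ => hK0 e) (Finset.mem_univ e)
  refine ⟨(J.orderEmbOfCardLe hcard).toEmbedding, fun i => ?_⟩
  exact (Finset.mem_filter.1 (J.orderEmbOfCardLe_mem hcard i)).2

end MomentCurve

/-! ### Strauss' inequality -/

section Strauss

variable {n : ℕ}

local notation "𝔼" => EuclideanSpace ℝ (Fin n)

/-- A single basis would bound only the product of components, which may vanish where `w` does not.
The good `n` directions depend on `x`, so the products over all choices `e` are summed. -/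
lemma exists_lintegral_rpow_le_of_line_bound (hn : 2 ≤ n) :
    ∃ C : ℝ≥0∞, C ≠ ⊤ ∧ ∀ (w : 𝔼 → 𝔼) (A : ℝ≥0∞), ContDiff ℝ 1 w →
      (∀ ξ, ∫⁻ x, ‖inner ℝ ξ (fderiv ℝ w x ξ)‖ₑ ≤ ‖ξ‖ₑ ^ 2 * A) →
      (∀ x ξ, ‖inner ℝ ξ (w x)‖ₑ ≤ ∫⁻ t : ℝ, ‖inner ℝ ξ (fderiv ℝ w (x + t • ξ) ξ)‖ₑ) →
      ∫⁻ x, ‖w x‖ₑ ^ ((n : ℝ) / ((n : ℝ) - 1)) ≤ C * A ^ ((n : ℝ) / ((n : ℝ) - 1)) := by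
  have hn' : (1 : ℝ) < n := by exact_mod_cast hn
  set p : ℝ := (n : ℝ) / ((n : ℝ) - 1) with hp
  set r : ℝ := (1 : ℝ) / ((n : ℝ) - 1) with hr
  have hp0 : 0 ≤ p := div_nonneg (by linarith) (by linarith)
  have hr0 : 0 ≤ r := div_nonneg zero_le_one (by linarith)
  have hrp : r * n = p := by rw [hr, hp]; ring
  obtain ⟨K, hK0, hK⟩ := exists_embedding_norm_le (n := n) (by omega)
  choose C hC hCle using fun e : Fin n ↪ Fin (2 * n - 1) =>
    exists_lintegral_prod_le hn (linearIndependent_momentVector (n := n) (e := fun i => (e i : ℕ))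
      (Fin.val_injective.comp e.injective))
  let Ξ : ℝ≥0∞ := ∑ k : Fin (2 * n - 1), ‖momentVector n k‖ₑ ^ 2
  have hΞ : Ξ ≠ ⊤ := ENNReal.sum_ne_top.2 fun k _ => ENNReal.pow_ne_top enorm_ne_top
  refine ⟨∑ e, ENNReal.ofReal K ^ p * (C e * Ξ ^ p), ?_, fun w A hw hD hline => ?_⟩
  · refine ENNReal.sum_ne_top.2 fun e _ => ENNReal.mul_ne_top
      (ENNReal.rpow_ne_top_of_nonneg hp0 ENNReal.ofReal_ne_top)
      (ENNReal.mul_ne_top (hC e) (ENNReal.rpow_ne_top_of_nonneg hp0 hΞ))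
  have hmeas : ∀ ξ : 𝔼, Measurable fun x => ‖inner ℝ ξ (w x)‖ₑ := fun ξ =>
    (continuous_const.inner hw.continuous).measurable.enorm
  have hmeas' : ∀ ξ : 𝔼, Measurable fun x => ‖inner ℝ ξ (fderiv ℝ w x ξ)‖ₑ := fun ξ =>
    (continuous_const.inner
      ((hw.continuous_fderiv one_ne_zero).clm_apply continuous_const)).measurable.enorm
  have hpt : ∀ x, ‖w x‖ₑ ^ p ≤ ∑ e : Fin n ↪ Fin (2 * n - 1),
      ENNReal.ofReal K ^ p * ∏ i, ‖inner ℝ (momentVector n (e i)) (w x)‖ₑ ^ r := by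
    intro x
    obtain ⟨e, he⟩ := hK (w x)
    have hsplit : ∀ a : ℝ≥0∞, a ^ p = ∏ _i : Fin n, a ^ r := by
      intro a
      rw [Finset.prod_const, Finset.card_univ, Fintype.card_fin, ← ENNReal.rpow_mul_natCast, hrp]
    refine le_trans ?_ (Finset.single_le_sum (f := fun e : Fin n ↪ Fin (2 * n - 1) =>
      ENNReal.ofReal K ^ p * ∏ i, ‖inner ℝ (momentVector n (e i)) (w x)‖ₑ ^ r)
      (fun _ _ => zero_le) (Finset.mem_univ e))
    rw [hsplit, hsplit, ← Finset.prod_mul_distrib]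
    refine Finset.prod_le_prod' fun i _ => ?_
    rw [← ENNReal.mul_rpow_of_nonneg _ _ hr0]
    refine ENNReal.rpow_le_rpow ?_ hr0
    rw [← ofReal_norm (w x), ← ofReal_norm (inner ℝ _ _), ← ENNReal.ofReal_mul hK0]
    exact ENNReal.ofReal_le_ofReal (he i)
  have hterm : ∀ e : Fin n ↪ Fin (2 * n - 1),
      ∫⁻ x, ∏ i, ‖inner ℝ (momentVector n (e i)) (w x)‖ₑ ^ r ≤ C e * (Ξ * A) ^ p := by
    intro e
    refine hCle e (fun i x => ‖inner ℝ (momentVector n (e i)) (w x)‖ₑ)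
      (fun i x => ‖inner ℝ (momentVector n (e i)) (fderiv ℝ w x (momentVector n (e i)))‖ₑ) (Ξ * A)
      (fun i => hmeas' _) (fun i x => hline x _) fun i => (hD _).trans ?_
    gcongr
    exact Finset.single_le_sum (f := fun k : Fin (2 * n - 1) => ‖momentVector n k‖ₑ ^ 2)
      (fun _ _ => zero_le) (Finset.mem_univ (e i))
  calc ∫⁻ x, ‖w x‖ₑ ^ p
      ≤ ∫⁻ x, ∑ e : Fin n ↪ Fin (2 * n - 1),
        ENNReal.ofReal K ^ p * ∏ i, ‖inner ℝ (momentVector n (e i)) (w x)‖ₑ ^ r :=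
        lintegral_mono hpt
    _ = ∑ e : Fin n ↪ Fin (2 * n - 1), ENNReal.ofReal K ^ p *
        ∫⁻ x, ∏ i, ‖inner ℝ (momentVector n (e i)) (w x)‖ₑ ^ r := by
        have hm : ∀ e : Fin n ↪ Fin (2 * n - 1), Measurable fun x =>
            ∏ i, ‖inner ℝ (momentVector n (e i)) (w x)‖ₑ ^ r := fun e =>
          Finset.measurable_fun_prod _ fun i _ => (hmeas _).pow_const r
        rw [lintegral_finsetSum _ fun e _ => (hm e).const_mul _]
        exact Finset.sum_congr rfl fun e _ => lintegral_const_mul _ (hm e)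
    _ ≤ ∑ e : Fin n ↪ Fin (2 * n - 1), ENNReal.ofReal K ^ p * (C e * (Ξ * A) ^ p) := by
        gcongr with e
        exact hterm e
    _ = (∑ e, ENNReal.ofReal K ^ p * (C e * Ξ ^ p)) * A ^ p := by
        refine Eq.trans ?_ (Finset.sum_mul _ _ _).symm
        refine Finset.sum_congr rfl fun e _ => ?_
        rw [ENNReal.mul_rpow_of_nonneg _ _ hp0]
        ring

/-- Strauss' inequality: the critical Lebesgue norm is controlled by the deformation. -/
lemma exists_lintegral_rpow_le_of_longitudinalBound (hn : 2 ≤ n) :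
    ∃ C : ℝ≥0∞, C ≠ ⊤ ∧ ∀ (v : 𝔼 → 𝔼) (A : ℝ≥0∞), Integrable v → LongitudinalBound v A →
      ∫⁻ x, ‖v x‖ₑ ^ ((n : ℝ) / ((n : ℝ) - 1)) ≤ C * A ^ ((n : ℝ) / ((n : ℝ) - 1)) := by
  obtain ⟨C, hC, hCle⟩ := exists_lintegral_rpow_le_of_line_bound hn
  refine ⟨C, hC, fun v A hv hA => ?_⟩
  obtain ⟨w, hw, hD, hline, hlim⟩ := hA.exists_smooth_approx hv
  set p : ℝ := (n : ℝ) / ((n : ℝ) - 1) with hp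
  calc ∫⁻ x, ‖v x‖ₑ ^ p = ∫⁻ x, liminf (fun k => ‖w k x‖ₑ ^ p) atTop := by
        refine lintegral_congr_ae ?_
        filter_upwards [hlim] with x hx
        exact (((ENNReal.continuous_rpow_const (y := p)).tendsto _).comp hx.enorm).liminf_eq.symm
    _ ≤ liminf (fun k => ∫⁻ x, ‖w k x‖ₑ ^ p) atTop :=
        lintegral_liminf_le fun k => (hw k).continuous.measurable.enorm.pow_const p
    _ ≤ liminf (fun _ => C * A ^ p) (atTop : Filter ℕ) :=
        liminf_le_liminf (Eventually.of_forall fun k => hCle _ _ (hw k) (hD k) (hline k))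
    _ = C * A ^ p := liminf_const _

/-- In one dimension the deformation controls the essential supremum. -/
lemma exists_ae_enorm_le_of_longitudinalBound :
    ∃ C : ℝ≥0∞, C ≠ ⊤ ∧ ∀ (v : EuclideanSpace ℝ (Fin 1) → EuclideanSpace ℝ (Fin 1)) (A : ℝ≥0∞),
      Integrable v → LongitudinalBound v A → ∀ᵐ x, ‖v x‖ₑ ≤ C * A := by
  let L : ℝ ≃L[ℝ] EuclideanSpace ℝ (Fin 1) := ContinuousLinearEquiv.ofFinrankEq (by simp)
  obtain ⟨c, -, hct, hc⟩ := L.exists_lintegral_comp_eq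
  set ξ := L 1 with hξ
  have hL : ∀ t, L t = t • ξ := fun t => by rw [hξ, ← map_smul, smul_eq_mul, mul_one]
  have hξ0 : ξ ≠ 0 := by simp [hξ]
  have hξe : ‖ξ‖ₑ ≠ 0 := by simpa using hξ0
  refine ⟨c * ‖ξ‖ₑ, ENNReal.mul_ne_top hct enorm_ne_top, fun v A hv hA => ?_⟩
  obtain ⟨w, hw, hD, hline, hlim⟩ := hA.exists_smooth_approx hv
  filter_upwards [hlim] with x hx
  refine le_of_tendsto' hx.enorm fun k => ?_
  -- In dimension one every vector is parallel to `ξ`, so Cauchy–Schwarz is an equality.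
  have hinner : ‖inner ℝ ξ (w k x)‖ₑ = ‖ξ‖ₑ * ‖w k x‖ₑ := by
    obtain ⟨s, hs⟩ := L.surjective (w k x)
    rw [← hs, hL, inner_smul_right, real_inner_self_eq_norm_sq, enorm_mul, enorm_smul, enorm_pow,
      enorm_norm]
    ring
  rw [← ENNReal.mul_le_mul_iff_right hξe enorm_ne_top, ← hinner]
  calc ‖inner ℝ ξ (w k x)‖ₑ
      ≤ ∫⁻ t : ℝ, ‖inner ℝ ξ (fderiv ℝ (w k) (x + t • ξ) ξ)‖ₑ := hline k x ξ
    _ = c * ∫⁻ y, ‖inner ℝ ξ (fderiv ℝ (w k) (x + y) ξ)‖ₑ := by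
        rw [← hc]
        simp only [hL]
    _ = c * ∫⁻ y, ‖inner ℝ ξ (fderiv ℝ (w k) y ξ)‖ₑ := by
        rw [lintegral_add_left_eq_self (fun y => ‖inner ℝ ξ (fderiv ℝ (w k) y ξ)‖ₑ) x]
    _ ≤ c * (‖ξ‖ₑ ^ 2 * A) := by gcongr; exact hD k ξ
    _ = ‖ξ‖ₑ * (c * ‖ξ‖ₑ * A) := by ring

end Strauss

/-! ### Standard mollifiers applied to `BD` functions -/

section Mollification

variable {n : ℕ}

local notation "𝔼" => EuclideanSpace ℝ (Fin n)

lemma IsStandardMollifier.rescaledMollifier_nonneg {ρ : 𝔼 → ℝ} (hρ : IsStandardMollifier ρ) {ε : ℝ}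
    (hε : 0 < ε) (x : 𝔼) : 0 ≤ rescaledMollifier ρ ε x :=
  mul_nonneg (by positivity) (hρ.nonneg _)

lemma IsStandardMollifier.rescaledMollifier_neg {ρ : 𝔼 → ℝ} (hρ : IsStandardMollifier ρ) (ε : ℝ)
    (x : 𝔼) : rescaledMollifier ρ ε (-x) = rescaledMollifier ρ ε x := by
  rw [rescaledMollifier, rescaledMollifier, hρ.radial (ε⁻¹ • -x) (ε⁻¹ • x) (by simp)]

lemma IsStandardMollifier.integrable_rescaledMollifier {ρ : 𝔼 → ℝ} (hρ : IsStandardMollifier ρ)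
    {ε : ℝ} (hε : 0 < ε) : Integrable (rescaledMollifier ρ ε) :=
  (hρ.integrable.comp_smul (inv_ne_zero hε.ne')).const_mul _

lemma IsStandardMollifier.integral_rescaledMollifier {ρ : 𝔼 → ℝ} (hρ : IsStandardMollifier ρ)
    {ε : ℝ} (hε : 0 < ε) : ∫ x, rescaledMollifier ρ ε x = 1 := by
  simp only [rescaledMollifier]
  rw [integral_const_mul, Measure.integral_comp_inv_smul_of_nonneg _ _ hε.le, hρ.integral_eq_one,
    finrank_euclideanSpace_fin, smul_eq_mul, mul_one, inv_mul_cancel₀ (by positivity)]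

lemma IsStandardMollifier.norm_le_of_rescaledMollifier_ne_zero {ρ : 𝔼 → ℝ}
    (hρ : IsStandardMollifier ρ) {ε : ℝ} (hε : 0 < ε) (x : 𝔼) (hx : rescaledMollifier ρ ε x ≠ 0) :
    ‖x‖ ≤ ε := by
  have h1 : ε⁻¹ • x ∈ closedBall (0 : 𝔼) 1 :=
    hρ.tsupport_subset (subset_tsupport _ (right_ne_zero_of_mul hx))
  rw [mem_closedBall_zero_iff, norm_smul, norm_inv, Real.norm_of_nonneg hε.le,
    inv_mul_le_iff₀ hε, mul_one] at h1
  exact h1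

lemma MemBD.integrable_sub_mollify {u : 𝔼 → 𝔼} (hu : MemBD u) {ρ : 𝔼 → ℝ}
    (hρ : IsStandardMollifier ρ) {ε : ℝ} (hε : 0 < ε) :
    Integrable fun x => u x - mollify ρ ε u x :=
  hu.integrable.sub ((hρ.integrable_rescaledMollifier hε).integrable_convolution _ hu.integrable)

lemma MemBD.longitudinalBound_sub_mollify {u : 𝔼 → 𝔼} (hu : MemBD u) {ρ : 𝔼 → ℝ}
    (hρ : IsStandardMollifier ρ) {ε : ℝ} (hε : 0 < ε) :
    LongitudinalBound (fun x => u x - mollify ρ ε u x) (2 * totalDeformation u) := by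
  rw [two_mul]
  exact hu.longitudinalBound.sub hu.integrable (hu.longitudinalBound.convolve hu.integrable
    (hρ.rescaledMollifier_nonneg hε) (hρ.integrable_rescaledMollifier hε)
    (hρ.integral_rescaledMollifier hε))

lemma MemBD.lintegral_sub_mollify_le {u : 𝔼 → 𝔼} (hu : MemBD u) {ρ : 𝔼 → ℝ}
    (hρ : IsStandardMollifier ρ) {ε : ℝ} (hε : 0 < ε) :
    ∫⁻ x, ‖u x - mollify ρ ε u x‖ₑ ≤ 12 * n * ENNReal.ofReal ε * totalDeformation u :=
  hu.longitudinalBound.lintegral_sub_convolution_le hu.integrable (hρ.rescaledMollifier_nonneg hε)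
    (hρ.integrable_rescaledMollifier hε) (hρ.integral_rescaledMollifier hε)
    (hρ.rescaledMollifier_neg ε) (hρ.norm_le_of_rescaledMollifier_ne_zero hε)

end Mollification

/-! ### Interpolation of Lebesgue norms -/

section Interpolation

variable {α : Type*} [MeasurableSpace α] {μ : Measure α}

/-- Hölder's inequality for `f^p = f^(pθ) (f^q)^(1 - pθ)` with weights `pθ` and `1 - pθ`. -/
lemma ENNReal.lintegral_rpow_interpolate {f : α → ℝ≥0∞} (hf : AEMeasurable f μ) {p q θ : ℝ}
    (hp : 0 < p) (hq : 0 < q) (hθ0 : 0 ≤ θ) (hθ1 : p * θ ≤ 1)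
    (hpq : 1 / p = θ + (1 - θ) / q) :
    (∫⁻ x, f x ^ p ∂μ) ^ (1 / p) ≤
      (∫⁻ x, f x ∂μ) ^ θ * ((∫⁻ x, f x ^ q ∂μ) ^ (1 / q)) ^ (1 - θ) := by
  have h1 : p * θ + q * (1 - p * θ) = p := by
    field_simp at hpq
    nlinarith
  have h2 : (1 - p * θ) * (1 / p) = 1 / q * (1 - θ) := by
    have : (1 - p * θ) * (1 / p) = 1 / p - θ := by field_simp
    rw [this, hpq]
    ring
  calc (∫⁻ x, f x ^ p ∂μ) ^ (1 / p)
      = (∫⁻ x, f x ^ (p * θ) * (f x ^ q) ^ (1 - p * θ) ∂μ) ^ (1 / p) := by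
        congr 2 with x
        rw [← ENNReal.rpow_mul, ← ENNReal.rpow_add_of_nonneg _ _ (by positivity)
          (mul_nonneg hq.le (by linarith)), h1]
    _ ≤ ((∫⁻ x, f x ∂μ) ^ (p * θ) * (∫⁻ x, f x ^ q ∂μ) ^ (1 - p * θ)) ^ (1 / p) := by
        refine ENNReal.rpow_le_rpow ?_ (by positivity)
        exact ENNReal.lintegral_mul_norm_pow_le hf (hf.pow_const q) (by positivity) (by linarith)
          (by ring)
    _ = _ := by
        rw [ENNReal.mul_rpow_of_nonneg _ _ (by positivity), ← ENNReal.rpow_mul, ← ENNReal.rpow_mul,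
          ← ENNReal.rpow_mul, h2]
        congr 2
        field_simp

lemma ENNReal.lintegral_rpow_le_of_ae_le {f : α → ℝ≥0∞} {M : ℝ≥0∞} (hM : M ≠ ⊤)
    (h : ∀ᵐ x ∂μ, f x ≤ M) {p : ℝ} (hp : 1 ≤ p) :
    (∫⁻ x, f x ^ p ∂μ) ^ (1 / p) ≤ (∫⁻ x, f x ∂μ) ^ (1 / p) * M ^ (1 - 1 / p) := by
  have hp0 : 0 < p := by linarith
  calc (∫⁻ x, f x ^ p ∂μ) ^ (1 / p) ≤ (∫⁻ x, f x * M ^ (p - 1) ∂μ) ^ (1 / p) := by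
        refine ENNReal.rpow_le_rpow (lintegral_mono_ae ?_) (by positivity)
        filter_upwards [h] with x hx
        calc f x ^ p = f x ^ (1 : ℝ) * f x ^ (p - 1) := by
              rw [← ENNReal.rpow_add_of_nonneg _ _ zero_le_one (by linarith), add_sub_cancel]
          _ ≤ f x * M ^ (p - 1) := by
              rw [ENNReal.rpow_one]
              gcongr
    _ = (∫⁻ x, f x ∂μ) ^ (1 / p) * M ^ (1 - 1 / p) := by
        rw [lintegral_mul_const' _ _ (ENNReal.rpow_ne_top_of_nonneg (by linarith) hM),
          ENNReal.mul_rpow_of_nonneg _ _ (by positivity), ← ENNReal.rpow_mul]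
        congr 2
        field_simp

lemma ENNReal.mul_rpow_mul_mul_rpow (a b s A : ℝ≥0∞) {θ : ℝ} (h0 : 0 ≤ θ) (h1 : θ ≤ 1) :
    (a * s * A) ^ θ * (b * A) ^ (1 - θ) = a ^ θ * b ^ (1 - θ) * s ^ θ * A := by
  have h1' : 0 ≤ 1 - θ := by linarith
  have hA : A ^ θ * A ^ (1 - θ) = A := by
    rw [← ENNReal.rpow_add_of_nonneg _ _ h0 h1', add_sub_cancel, ENNReal.rpow_one]
  rw [ENNReal.mul_rpow_of_nonneg _ _ h0, ENNReal.mul_rpow_of_nonneg _ _ h0,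
    ENNReal.mul_rpow_of_nonneg _ _ h1']
  calc _ = a ^ θ * b ^ (1 - θ) * s ^ θ * (A ^ θ * A ^ (1 - θ)) := by ring
    _ = _ := by rw [hA]

end Interpolation

/-! ### Subcritical norms from the two endpoints -/

section Estimate

variable {n : ℕ}

local notation "𝔼" => EuclideanSpace ℝ (Fin n)

lemma exists_eLpNorm_le_of_two_le (hn : 2 ≤ n) {p : ℝ≥0∞} (hp₁ : 1 ≤ p)
    (hp₂ : p ≤ (n : ℝ≥0∞) / ((n : ℝ≥0∞) - 1)) :
    (0 ≤ 1 - (n : ℝ) + n * (p⁻¹).toReal ∧ 1 - (n : ℝ) + n * (p⁻¹).toReal ≤ 1) ∧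
    ∃ C : ℝ≥0∞, C ≠ ⊤ ∧ ∀ (v : 𝔼 → 𝔼) (A : ℝ≥0∞), A ≠ ⊤ → Integrable v → LongitudinalBound v A →
      eLpNorm v p volume ≤ (∫⁻ x, ‖v x‖ₑ) ^ (1 - (n : ℝ) + n * (p⁻¹).toReal) *
        (C * A) ^ (1 - (1 - (n : ℝ) + n * (p⁻¹).toReal)) := by
  have hn' : (1 : ℝ) < n := by exact_mod_cast hn
  have hn0 : (0 : ℝ) < n - 1 := by linarith
  have hn1 : (1 : ℝ≥0∞) ≤ n := by exact_mod_cast (by omega : 1 ≤ n)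
  have hsub : ((n : ℝ≥0∞) - 1).toReal = n - 1 := by
    rw [ENNReal.toReal_sub_of_le hn1 (ENNReal.natCast_ne_top n)]
    simp
  have hsub0 : (n : ℝ≥0∞) - 1 ≠ 0 := by
    intro h
    rw [h] at hsub
    simp at hsub
    linarith
  have hqt : (n : ℝ≥0∞) / ((n : ℝ≥0∞) - 1) ≠ ⊤ := ENNReal.div_ne_top (ENNReal.natCast_ne_top n) hsub0
  have hpt : p ≠ ⊤ := ne_top_of_le_ne_top hqt hp₂
  set P : ℝ := p.toReal with hP
  set q : ℝ := (n : ℝ) / ((n : ℝ) - 1) with hq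
  have hq0 : 0 < q := by positivity
  have hP1 : 1 ≤ P := by simpa using (ENNReal.toReal_le_toReal ENNReal.one_ne_top hpt).2 hp₁
  have hP0 : 0 < P := by linarith
  have hPq : P * (n - 1) ≤ n := by
    have := (ENNReal.toReal_le_toReal hpt hqt).2 hp₂
    rw [ENNReal.toReal_div, hsub, ENNReal.toReal_natCast, le_div_iff₀ hn0] at this
    exact this
  have hinv : (p⁻¹).toReal = 1 / P := by rw [ENNReal.toReal_inv, one_div]
  rw [hinv]
  -- This `θ` solves `1/p = θ + (1 - θ)/q` with `q = n/(n-1)`.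
  set θ : ℝ := 1 - (n : ℝ) + n * (1 / P) with hθ
  have hPθ : P * θ = P - P * n + n := by rw [hθ]; field_simp
  have hθ0 : 0 ≤ θ := by
    by_contra! h
    nlinarith
  have hPθ1 : P * θ ≤ 1 := by rw [hPθ]; nlinarith
  have hθ1 : θ ≤ 1 := by nlinarith
  refine ⟨⟨hθ0, hθ1⟩, ?_⟩
  obtain ⟨C, hC, hCle⟩ := exists_lintegral_rpow_le_of_longitudinalBound hn
  refine ⟨C ^ (1 / q), ENNReal.rpow_ne_top_of_nonneg (by positivity) hC, fun v A _ hv hA => ?_⟩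
  have hp0 : p ≠ 0 := (zero_lt_one.trans_le hp₁).ne'
  rw [eLpNorm_eq_lintegral_rpow_enorm_toReal hp0 hpt]
  refine (ENNReal.lintegral_rpow_interpolate hv.1.enorm hP0 hq0 hθ0 hPθ1 ?_).trans ?_
  · rw [hq, hθ]
    field_simp
    ring
  · gcongr
    calc (∫⁻ x, ‖v x‖ₑ ^ q) ^ (1 / q) ≤ (C * A ^ q) ^ (1 / q) := by
          gcongr
          exact hCle v A hv hA
      _ = C ^ (1 / q) * A := by
            rw [ENNReal.mul_rpow_of_nonneg _ _ (by positivity), ← ENNReal.rpow_mul,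
              mul_one_div_cancel hq0.ne', ENNReal.rpow_one]

lemma exists_eLpNorm_le_of_eq_one {p : ℝ≥0∞} (hp₁ : 1 ≤ p) :
    ∃ C : ℝ≥0∞, C ≠ ⊤ ∧
      ∀ (v : EuclideanSpace ℝ (Fin 1) → EuclideanSpace ℝ (Fin 1)) (A : ℝ≥0∞), A ≠ ⊤ →
        Integrable v → LongitudinalBound v A →
        eLpNorm v p volume ≤ (∫⁻ x, ‖v x‖ₑ) ^ (p⁻¹).toReal * (C * A) ^ (1 - (p⁻¹).toReal) := by
  obtain ⟨C, hC, hCle⟩ := exists_ae_enorm_le_of_longitudinalBound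
  refine ⟨C, hC, fun v A hAt hv hA => ?_⟩
  rcases eq_or_ne p ⊤ with rfl | hpt
  · simpa using eLpNormEssSup_le_of_ae_enorm_bound (hCle v A hv hA)
  have hp0 : p ≠ 0 := (zero_lt_one.trans_le hp₁).ne'
  have hP1 : 1 ≤ p.toReal := by
    simpa using (ENNReal.toReal_le_toReal ENNReal.one_ne_top hpt).2 hp₁
  rw [eLpNorm_eq_lintegral_rpow_enorm_toReal hp0 hpt, ENNReal.toReal_inv, ← one_div]
  exact ENNReal.lintegral_rpow_le_of_ae_le (ENNReal.mul_ne_top hC hAt) (hCle v A hv hA) hP1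

lemma exists_eLpNorm_le (hn : 1 ≤ n) {p : ℝ≥0∞} (hp₁ : 1 ≤ p)
    (hp₂ : p ≤ (n : ℝ≥0∞) / ((n : ℝ≥0∞) - 1)) :
    (0 ≤ 1 - (n : ℝ) + n * (p⁻¹).toReal ∧ 1 - (n : ℝ) + n * (p⁻¹).toReal ≤ 1) ∧
    ∃ C : ℝ≥0∞, C ≠ ⊤ ∧ ∀ (v : 𝔼 → 𝔼) (A : ℝ≥0∞), A ≠ ⊤ → Integrable v → LongitudinalBound v A →
      eLpNorm v p volume ≤ (∫⁻ x, ‖v x‖ₑ) ^ (1 - (n : ℝ) + n * (p⁻¹).toReal) *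
        (C * A) ^ (1 - (1 - (n : ℝ) + n * (p⁻¹).toReal)) := by
  -- For `n = 1` the upper bound on `p` reads `1/0 = ⊤`, so `p = ∞` is allowed; the exponent is then
  -- `1/p`, which is 0 at infinity.
  rcases hn.eq_or_lt with rfl | hn2
  · have h1 : (p⁻¹).toReal ≤ 1 := by
      simpa using ENNReal.toReal_mono ENNReal.one_ne_top (ENNReal.inv_le_one.2 hp₁)
    have h2 : 1 - ((1 : ℕ) : ℝ) + ((1 : ℕ) : ℝ) * (p⁻¹).toReal = (p⁻¹).toReal := by
      rw [Nat.cast_one]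
      ring
    rw [h2]
    exact ⟨⟨ENNReal.toReal_nonneg, h1⟩, exists_eLpNorm_le_of_eq_one hp₁⟩
  · exact exists_eLpNorm_le_of_two_le hn2 hp₁ hp₂

end Estimate

theorem corollary5p3 (n : ℕ) (hn : 1 ≤ n) (p : ℝ≥0∞) (hp₁ : 1 ≤ p)
    (hp₂ : p ≤ (n : ℝ≥0∞) / ((n : ℝ≥0∞) - 1)) :
    ∃ c : ℝ, 0 < c ∧
      ∀ u : EuclideanSpace ℝ (Fin n) → EuclideanSpace ℝ (Fin n), MemBD u →
      ∀ ε : ℝ, 0 < ε →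
      ∀ ρ : EuclideanSpace ℝ (Fin n) → ℝ, IsStandardMollifier ρ →
        eLpNorm (fun x => u x - mollify ρ ε u x) p volume ≤
          ENNReal.ofReal (c * ε ^ (1 - (n : ℝ) + (n : ℝ) * (p⁻¹).toReal)) *
            totalDeformation u := by
  obtain ⟨⟨hθ0, hθ1⟩, C, hC, hCle⟩ := exists_eLpNorm_le hn hp₁ hp₂
  set θ : ℝ := 1 - (n : ℝ) + (n : ℝ) * (p⁻¹).toReal with hθ
  have hθ1' : 0 ≤ 1 - θ := by linarith
  set K : ℝ≥0∞ := (12 * n) ^ θ * (C * 2) ^ (1 - θ) with hK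
  have hKt : K ≠ ⊤ := ENNReal.mul_ne_top
    (ENNReal.rpow_ne_top_of_nonneg hθ0 (ENNReal.mul_ne_top (by simp) (ENNReal.natCast_ne_top n)))
    (ENNReal.rpow_ne_top_of_nonneg hθ1' (ENNReal.mul_ne_top hC (by simp)))
  -- Adding 1 makes positivity of the constant immediate.
  refine ⟨K.toReal + 1, by positivity, fun u hu ε hε ρ hρ => ?_⟩
  calc eLpNorm (fun x => u x - mollify ρ ε u x) p volume
      ≤ (∫⁻ x, ‖u x - mollify ρ ε u x‖ₑ) ^ θ * (C * (2 * totalDeformation u)) ^ (1 - θ) :=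
        hCle _ _ (ENNReal.mul_ne_top (by simp) hu.totalDeformation_lt_top.ne)
          (hu.integrable_sub_mollify hρ hε) (hu.longitudinalBound_sub_mollify hρ hε)
    _ ≤ (12 * n * ENNReal.ofReal ε * totalDeformation u) ^ θ *
        (C * 2 * totalDeformation u) ^ (1 - θ) := by
        rw [mul_assoc C]
        gcongr
        exact hu.lintegral_sub_mollify_le hρ hε
    _ = K * ENNReal.ofReal ε ^ θ * totalDeformation u :=
        ENNReal.mul_rpow_mul_mul_rpow _ _ _ _ hθ0 hθ1
    _ ≤ ENNReal.ofReal ((K.toReal + 1) * ε ^ θ) * totalDeformation u := by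
        rw [ENNReal.ofReal_mul (by positivity), ENNReal.ofReal_rpow_of_pos hε]
        gcongr
        exact (ENNReal.le_ofReal_iff_toReal_le hKt (by positivity)).2 (by linarith)
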